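/- Let $d\ge 2$ and let $G$ be a probability measure on $\mathbb R$ such that, for some $b>a>0$ and $\alpha>0$, $G$ is supported on $[a,b]$ and is absolutely continuous with a density $\rho$ satisfying $\rho(x)\ge\alpha$ for almost all $x\in[a,b]$. Consider first-passage percolation on the hypercubic lattice $(\mathbb Z^d,E(\mathbb Z^d))$: the edges $e\in E(\mathbb Z^d)$ carry independent weights $t_e$ with common distribution $G$, a finite path $p$ has passage time $T(p)=\sum_{e\in p}t_e$, the passage time between $u,v\in\mathbb Z^d$ is $T(u,v)=\inf_p T(p)$ over all finite paths $p$ connecting $u$ and $v$, and $\gamma(u,v)$ denotes the geodesic between $u$ and $v$, that is, the almost surely unique path achieving this infimum. Let $\|v\|$ be the $\ell^2$ norm of $v$. Then for every real $\beta\ge1$ there exists $C_\beta>0$, depending only on $d$, $G$ and $\beta$, such that for all $v\in\mathbb Z^d$ with $\|v\|\ge2$, $$\sum_{e\in E(\mathbb Z^d)}\mathbb P(e\in\gamma(0,v))^\beta\le C_\beta\begin{cases}\|v\|^{\left(\frac{d-1}{d+1}\right)\left(\frac{2d}{d-1}-\beta\right)}(\log\|v\|)^{(\beta-1)d} & \text{if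 } 1\le\beta<\frac{2d}{d-1},\\[2pt] (\log\|v\|)^{\frac{d(d+1)}{d-1}+1} & \text{if } \beta=\frac{2d}{d-1},\\[2pt] (\log\|v\|)^{\frac{d(d+1)}{d-1}} & \text{if } \beta>\frac{2d}{d-1}.\end{cases}$$ In particular (the case $\beta=2$), there exists $C>0$, depending only on $d$ and $G$, such that for all $v\in\mathbb Z^d$ with $\|v\|\ge2$, $$\sum_{e\in E(\mathbb Z^d)}\mathbb P(e\in\gamma(0,v))^2\le C\,\|v\|^{\frac{2}{d+1}}(\log\|v\|)^d.$$ -/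

import Mathlib

open MeasureTheory
open scoped ENNReal

namespace FPP

/-- The hypercubic lattice `ℤ^d`: two vertices are adjacent iff their `ℓ¹` distance is `1`. -/
def lattice (d : ℕ) : SimpleGraph (Fin d → ℤ) where
  Adj x y := ∑ i, |x i - y i| = 1
  symm := ⟨fun x y h => by simpa only [abs_sub_comm] using h⟩
  loopless := ⟨fun x h => by simp at h⟩

/-- The edge set `E(ℤ^d)` (unoriented edges), as a type. -/
abbrev Edge (d : ℕ) : Type := (lattice d).edgeSet

/-- The passage time `T(p) = ∑_{e ∈ p} t_e` of a finite lattice path `p` in the environment `t`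
(an edge that is traversed several times is counted with multiplicity). -/
def pathTime {d : ℕ} (t : Edge d → ℝ) {u v : Fin d → ℤ} (p : (lattice d).Walk u v) : ℝ :=
  (p.darts.map fun a => t ⟨a.edge, a.edge_mem⟩).sum

/-- The passage time `T(u,v) = inf_p T(p)` over all finite paths `p` connecting `u` and `v`. -/
noncomputable def passageTime {d : ℕ} (t : Edge d → ℝ) (u v : Fin d → ℤ) : ℝ :=
  ⨅ p : (lattice d).Walk u v, pathTime t p

/-- A geodesic between `u` and `v` is a path achieving the infimum `T(u,v)`. -/
def IsGeodesic {d : ℕ} (t : Edge d → ℝ) {u v : Fin d → ℤ} (p : (lattice d).Walk u v) : Prop :=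
  pathTime t p = passageTime t u v

/-- The set of edges of `γ(u,v)`. For an atomless weight distribution supported in `(0,∞)` there is
almost surely exactly one geodesic between `u` and `v`, so that the set below is the edge set of
that geodesic; on the exceptional null event all geodesics are taken together. -/
def geodesic {d : ℕ} (t : Edge d → ℝ) (u v : Fin d → ℤ) : Set (Edge d) :=
  {e | ∃ p : (lattice d).Walk u v, IsGeodesic t p ∧ (e : Sym2 (Fin d → ℤ)) ∈ p.edges}

/-- The law of the environment: the weights `t_e`, `e ∈ E(ℤ^d)`, are independent with common
distribution `G`. -/
noncomputable def envMeasure (d : ℕ) (G : Measure ℝ) : Measure (Edge d → ℝ) :=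
  Measure.infinitePi fun _ : Edge d => G

/-- The influence `ℙ(e ∈ γ(0,v))`. -/
noncomputable def influence {d : ℕ} (G : Measure ℝ) (v : Fin d → ℤ) (e : Edge d) : ℝ≥0∞ :=
  envMeasure d G {t | e ∈ geodesic t 0 v}

/-- The assumption on the weight distribution: for some `b > a > 0` and `α > 0`, `G` is supported on
`[a,b]` and absolutely continuous with a density `ρ` such that `ρ ≥ α` almost everywhere on
`[a,b]`. -/
def IsAdmissibleWeight (G : Measure ℝ) : Prop :=
  ∃ a b α : ℝ, 0 < a ∧ a < b ∧ 0 < α ∧ G (Set.Icc a b)ᶜ = 0 ∧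
    ∃ ρ : ℝ → ℝ≥0∞, Measurable ρ ∧ G = volume.withDensity ρ ∧
      ∀ᵐ x ∂(volume.restrict (Set.Icc a b)), ENNReal.ofReal α ≤ ρ x

/-- The `ℓ²` norm of a lattice point. -/
noncomputable def norm2 {d : ℕ} (v : Fin d → ℤ) : ℝ :=
  √(∑ i, (v i : ℝ) ^ 2)

end FPP

/-! The heart of the proof is a bound on the number `N` of edges of influence at least `ε`: up to
powers of `log ‖v‖`, `N ≲ ε^(-2d/(d-1))`. Compare `T(0,v)` with its average over the translates
`T(x,x+v)`, where `x` runs over a cube of side `w`. The difference `F` is `O(w)`, since moving the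
endpoints by `O(w)` changes a passage time by `O(w)`. Yet the averaged time hardly depends on any
single edge: by translation invariance the averaged influence of an edge is the expected number of
visits of `γ(0,v)` to a set of `w^d` nearby edges, divided by `w^d`. A geodesic has `O(w)` edges in
a ball of radius `O(w)`, so this is `O(w^(1-d))`.

To exploit the contrast, pair `F` with the sum over a set `U` of edges of a bounded score `s(t_e)`
(`exists_score`). Pairing with a score is a difference operator in `t_e`, so scores of distinct
edges are orthogonal and the total pairing is at most `O(w √|U|)` (`sum_integral_score_mul_le`).
Edge by edge, the pairing with `T(0,v)` is bounded below by the probability that `e` lies on the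
geodesic with a weight not too close to `a`, and the pairing with `T(x,x+v)` is bounded above by the
influence of `e`. This gives `ε N ≲ |U| w^(1-d) + w √|U|` (`mul_card_le_of_le_influence`), and
optimizing `w` gives the count (`le_of_forall_scale`).

The lower bound ignores edges of weight near `a`. A large deviation estimate shows that, outside an
event of negligible probability, at least half of the edges in every stretch of the geodesic of
length `R ≍ log ‖v‖` are not of this kind. Hence `U` is taken to be the `R`-thickening of the set of
influential edges; its size, at most a constant times `R^d N`, is the source of the logarithms.

Finally `∑ ℙ(e ∈ γ)^β` is split dyadically (`sum_rpow_le_of_card_le`): the counting bound handles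
large influences, and `∑ ℙ(e ∈ γ) = O(‖v‖)` handles small ones. The exponent `2d/(d-1)` is critical
because there all dyadic levels contribute equally. -/

namespace FPP

variable {d : ℕ}

/-! ### Lattice geometry, walks and their edge lists. -/

/-- The `ℓ¹` norm of a lattice point. -/
def l1 (x : Fin d → ℤ) : ℕ := ∑ i, (x i).natAbs

lemma l1_zero : l1 (0 : Fin d → ℤ) = 0 := by simp [l1]

lemma l1_neg (x : Fin d → ℤ) : l1 (-x) = l1 x := by simp [l1]

lemma l1_sub_comm (x y : Fin d → ℤ) : l1 (x - y) = l1 (y - x) := by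
  rw [← l1_neg, neg_sub]

lemma l1_add_le (x y : Fin d → ℤ) : l1 (x + y) ≤ l1 x + l1 y := by
  simp only [l1, ← Finset.sum_add_distrib]
  exact Finset.sum_le_sum fun i _ => Int.natAbs_add_le _ _

lemma l1_sub_le (x y z : Fin d → ℤ) : l1 (x - z) ≤ l1 (x - y) + l1 (y - z) := by
  simpa using l1_add_le (x - y) (y - z)

lemma l1_eq_zero {x : Fin d → ℤ} : l1 x = 0 ↔ x = 0 := by
  simp [l1, funext_iff]

lemma lattice_adj_iff {x y : Fin d → ℤ} : (lattice d).Adj x y ↔ l1 (x - y) = 1 := by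
  change ∑ i, |x i - y i| = 1 ↔ ∑ i, ((x - y) i).natAbs = 1
  rw [← Nat.cast_inj (R := ℤ)]
  simp

lemma exists_walk_length_eq (x y : Fin d → ℤ) :
    ∃ p : (lattice d).Walk x y, p.length = l1 (y - x) := by
  induction h : l1 (y - x) generalizing x with
  | zero =>
    obtain rfl : y = x := sub_eq_zero.1 (l1_eq_zero.1 h)
    exact ⟨.nil, rfl⟩
  | succ n ih =>
    obtain ⟨i, hi⟩ : ∃ i, (y - x) i ≠ 0 := by
      by_contra! hc
      have : y - x = 0 := funext hc
      rw [this, l1_zero] at h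
      omega
    let x' : Fin d → ℤ := Function.update x i (x i + (y i - x i).sign)
    have hi' : y i - x i ≠ 0 := hi
    have hsum : ∀ z : Fin d → ℤ, l1 z = (z i).natAbs + ∑ j ∈ Finset.univ.erase i, (z j).natAbs :=
      fun z => (Finset.add_sum_erase _ _ (Finset.mem_univ i)).symm
    have hadj : (lattice d).Adj x x' := by
      rw [lattice_adj_iff, hsum]
      have : ∑ j ∈ Finset.univ.erase i, ((x - x') j).natAbs = 0 := by
        refine Finset.sum_eq_zero fun j hj => ?_
        simp [x', Finset.ne_of_mem_erase hj]
      rw [this]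
      rcases lt_or_gt_of_ne hi' with h1 | h1
      · simp [x', Int.sign_eq_neg_one_of_neg h1]
      · simp [x', Int.sign_eq_one_of_pos h1]
    have hl : l1 (y - x') = n := by
      rw [hsum] at h ⊢
      have h2 : ∑ j ∈ Finset.univ.erase i, ((y - x') j).natAbs =
          ∑ j ∈ Finset.univ.erase i, ((y - x) j).natAbs := by
        refine Finset.sum_congr rfl fun j hj => ?_
        simp [x', Finset.ne_of_mem_erase hj]
      rw [h2]
      have h3 : ((y - x') i).natAbs + 1 = ((y - x) i).natAbs := by
        rcases lt_or_gt_of_ne hi' with h1 | h1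
        · simp only [x', Pi.sub_apply, Function.update_self, Int.sign_eq_neg_one_of_neg h1]
          omega
        · simp only [x', Pi.sub_apply, Function.update_self, Int.sign_eq_one_of_pos h1]
          omega
      omega
    obtain ⟨p, hp⟩ := ih x' hl
    exact ⟨.cons hadj p, by simp [hp]⟩

lemma l1_getVert_sub_le {u v : Fin d → ℤ} (p : (lattice d).Walk u v) {i j : ℕ} (hij : i ≤ j) :
    l1 (p.getVert j - p.getVert i) ≤ j - i := by
  induction j, hij using Nat.le_induction with
  | base => simp [l1_zero]
  | succ j hj ih =>
    refine (l1_sub_le _ (p.getVert j) _).trans ?_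
    have : l1 (p.getVert (j + 1) - p.getVert j) ≤ 1 := by
      by_cases h : j < p.length
      · rw [l1_sub_comm, lattice_adj_iff.1 (p.adj_getVert_succ h)]
      · rw [p.getVert_of_length_le (by omega), p.getVert_of_length_le (by omega)]
        simp [l1_zero]
    omega

lemma finite_setOf_l1_sub_le (x : Fin d → ℤ) (n : ℕ) : {y : Fin d → ℤ | l1 (y - x) ≤ n}.Finite := by
  refine (Set.finite_Icc (x - fun _ => (n : ℤ)) (x + fun _ => (n : ℤ))).subset fun y hy => ?_
  have : ∀ i, (y i - x i).natAbs ≤ n := fun i =>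
    (Finset.single_le_sum (f := fun i => ((y - x) i).natAbs) (fun _ _ => Nat.zero_le _)
      (Finset.mem_univ i)).trans hy
  refine ⟨fun i => ?_, fun i => ?_⟩ <;> have := this i <;> simp <;> omega

noncomputable instance : (lattice d).LocallyFinite := fun x =>
  ((finite_setOf_l1_sub_le x 1).subset fun y hy => by
    have := lattice_adj_iff.1 ((lattice d).adj_symm hy)
    exact this.le).fintype

instance (u v : Fin d → ℤ) : Countable ((lattice d).Walk u v) := by
  have : Countable (lattice d).Dart :=
    Function.Injective.countable (f := SimpleGraph.Dart.toProd)
      SimpleGraph.Dart.toProd_injective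
  exact SimpleGraph.Walk.darts_injective.countable

instance : Countable (Sym2 (Fin d → ℤ)) := Quot.mk_surjective.countable

/-- The list of edges of a walk, as elements of the edge set of the lattice. -/
def edgeList {u v : Fin d → ℤ} (p : (lattice d).Walk u v) : List (Edge d) :=
  p.darts.map fun a => ⟨a.edge, a.edge_mem⟩

section edgeList

variable {u v w : Fin d → ℤ}

lemma map_val_edgeList (p : (lattice d).Walk u v) :
    (edgeList p).map Subtype.val = p.edges := by
  simp [edgeList, SimpleGraph.Walk.edges, Function.comp_def]

lemma mem_edgeList {p : (lattice d).Walk u v} {e : Edge d} :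
    e ∈ edgeList p ↔ (e : Sym2 (Fin d → ℤ)) ∈ p.edges := by
  rw [← map_val_edgeList, List.mem_map]
  exact ⟨fun h => ⟨e, h, rfl⟩, fun ⟨e', h, h'⟩ => Subtype.ext h' ▸ h⟩

lemma pathTime_eq_sum (t : Edge d → ℝ) (p : (lattice d).Walk u v) :
    pathTime t p = ((edgeList p).map t).sum := by
  simp [pathTime, edgeList, Function.comp_def]

@[simp] lemma edgeList_append (p : (lattice d).Walk u v) (q : (lattice d).Walk v w) :
    edgeList (p.append q) = edgeList p ++ edgeList q := by
  simp [edgeList]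

@[simp] lemma length_edgeList (p : (lattice d).Walk u v) : (edgeList p).length = p.length := by
  simp [edgeList]

lemma edgeList_take (p : (lattice d).Walk u v) (n : ℕ) :
    edgeList (p.take n) = (edgeList p).take n := by
  simp [edgeList, SimpleGraph.Walk.darts_take, List.map_take]

lemma edgeList_drop (p : (lattice d).Walk u v) (n : ℕ) :
    edgeList (p.drop n) = (edgeList p).drop n := by
  simp [edgeList, SimpleGraph.Walk.darts_drop, List.map_drop]

lemma nodup_edgeList {p : (lattice d).Walk u v} (hp : p.IsPath) : (edgeList p).Nodup := by
  have := hp.isTrail.edges_nodup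
  rw [← map_val_edgeList] at this
  exact this.of_map _

lemma val_getElem_edgeList (p : (lattice d).Walk u v) {i : ℕ} (hi : i < (edgeList p).length) :
    ((edgeList p)[i] : Sym2 (Fin d → ℤ)) = s(p.getVert i, p.getVert (i + 1)) := by
  have h1 : i < p.edges.length := by simpa using hi
  rw [← SimpleGraph.Walk.getElem_edges h1]
  simp [← map_val_edgeList]

lemma pathTime_append (t : Edge d → ℝ) (p : (lattice d).Walk u v) (q : (lattice d).Walk v w) :
    pathTime t (p.append q) = pathTime t p + pathTime t q := by
  simp [pathTime_eq_sum]

lemma pathTime_mono {t t' : Edge d → ℝ} (h : ∀ e, t e ≤ t' e) (p : (lattice d).Walk u v) :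
    pathTime t p ≤ pathTime t' p := by
  rw [pathTime_eq_sum, pathTime_eq_sum]
  exact List.sum_le_sum fun e _ => h e

lemma pathTime_const (c : ℝ) (p : (lattice d).Walk u v) :
    pathTime (fun _ => c) p = p.length * c := by
  simp [pathTime_eq_sum]

lemma pathTime_update (t : Edge d → ℝ) (e : Edge d) (s : ℝ) (p : (lattice d).Walk u v) :
    pathTime (Function.update t e s) p =
      pathTime t p + (edgeList p).count e * (s - t e) := by
  rw [pathTime_eq_sum, pathTime_eq_sum]
  induction edgeList p with
  | nil => simp
  | cons a l ih =>
    by_cases h : a = e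
    · subst h
      simp only [List.map_cons, List.sum_cons, ih, Function.update_self, List.count_cons_self]
      push_cast
      ring
    · simp only [List.map_cons, List.sum_cons, ih, Function.update_of_ne h,
        List.count_cons_of_ne h]
      ring

lemma count_edgeList_of_notMem {p : (lattice d).Walk u v} {e : Edge d} (h : e ∉ edgeList p) :
    (edgeList p).count e = 0 := List.count_eq_zero.2 h

lemma pathTime_bypass_le {t : Edge d → ℝ} (ht : ∀ e, 0 ≤ t e) (p : (lattice d).Walk u v) :
    pathTime t p.bypass ≤ pathTime t p := by
  unfold pathTime
  refine List.Sublist.sum_le_sum (p.darts_bypass_sublist_darts.map _) ?_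
  intro x hx
  obtain ⟨a, -, rfl⟩ := List.mem_map.1 hx
  exact ht _

end edgeList

/-! ### Passage times, geodesics and the effect of changing one weight. -/

section passageTime

variable {u v : Fin d → ℤ} {t : Edge d → ℝ}

lemma pathTime_nonneg (ht : ∀ e, 0 ≤ t e) (p : (lattice d).Walk u v) : 0 ≤ pathTime t p := by
  have := pathTime_mono ht p
  rwa [pathTime_const, mul_zero] at this

lemma bddBelow_pathTime (ht : ∀ e, 0 ≤ t e) (u v : Fin d → ℤ) :
    BddBelow (Set.range fun p : (lattice d).Walk u v => pathTime t p) :=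
  ⟨0, by rintro _ ⟨p, rfl⟩; exact pathTime_nonneg ht p⟩

lemma passageTime_le (ht : ∀ e, 0 ≤ t e) (p : (lattice d).Walk u v) :
    passageTime t u v ≤ pathTime t p := ciInf_le (bddBelow_pathTime ht u v) p

instance (u v : Fin d → ℤ) : Nonempty ((lattice d).Walk u v) := ⟨(exists_walk_length_eq u v).choose⟩

lemma passageTime_mono {t' : Edge d → ℝ} (ht : ∀ e, 0 ≤ t e) (h : ∀ e, t e ≤ t' e)
    (u v : Fin d → ℤ) : passageTime t u v ≤ passageTime t' u v :=
  le_ciInf fun p => (passageTime_le ht p).trans (pathTime_mono h p)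

lemma passageTime_nonneg (ht : ∀ e, 0 ≤ t e) (u v : Fin d → ℤ) : 0 ≤ passageTime t u v :=
  le_ciInf fun p => pathTime_nonneg ht p

lemma passageTime_le_mul_l1 {b : ℝ} (ht : ∀ e, 0 ≤ t e) (hb : ∀ e, t e ≤ b) (u v : Fin d → ℤ) :
    passageTime t u v ≤ b * l1 (v - u) := by
  obtain ⟨p, hp⟩ := exists_walk_length_eq u v
  refine (passageTime_le ht p).trans ((pathTime_mono hb p).trans ?_)
  rw [pathTime_const, hp, mul_comm]

lemma length_mul_le_pathTime {a : ℝ} (ht : ∀ e, a ≤ t e) (p : (lattice d).Walk u v) :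
    a * p.length ≤ pathTime t p := by
  have := pathTime_mono ht p
  rwa [pathTime_const, mul_comm] at this

lemma passageTime_triangle (ht : ∀ e, 0 ≤ t e) (x y z : Fin d → ℤ) :
    passageTime t x z ≤ passageTime t x y + passageTime t y z := by
  refine le_ciInf_add_ciInf fun p q => ?_
  rw [← pathTime_append]
  exact passageTime_le ht _

lemma abs_passageTime_sub_le {b : ℝ} (ht : ∀ e, 0 ≤ t e) (hb : ∀ e, t e ≤ b)
    (x x' y y' : Fin d → ℤ) :
    |passageTime t x y - passageTime t x' y'| ≤ b * l1 (x - x') + b * l1 (y - y') := by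
  have key : ∀ x x' y y' : Fin d → ℤ,
      passageTime t x y ≤ passageTime t x' y' + (b * l1 (x - x') + b * l1 (y - y')) := by
    intro x x' y y'
    have h1 := passageTime_triangle ht x x' y
    have h2 := passageTime_triangle ht x' y' y
    have h3 := passageTime_le_mul_l1 ht hb x x'
    have h4 := passageTime_le_mul_l1 ht hb y' y
    rw [l1_sub_comm] at h3
    linarith
  rw [abs_sub_le_iff]
  have h1 := key x x' y y'
  have h2 := key x' x y' y
  rw [l1_sub_comm x' x, l1_sub_comm y' y] at h2
  constructor <;> linarith

/-- Weights bounded below by `a > 0` make every long walk slower than a reference walk `p₀`, so only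
finitely many walks compete. Removing loops from a minimizer costs nothing. -/
lemma exists_isGeodesic_isPath {a : ℝ} (ha : 0 < a) (ht : ∀ e, a ≤ t e) (u v : Fin d → ℤ) :
    ∃ p : (lattice d).Walk u v, IsGeodesic t p ∧ p.IsPath := by
  have ht0 : ∀ e, 0 ≤ t e := fun e => ha.le.trans (ht e)
  obtain ⟨p₀⟩ : Nonempty ((lattice d).Walk u v) := inferInstance
  obtain ⟨n, hn⟩ := exists_nat_gt (pathTime t p₀ / a)
  have hn' : ∀ p : (lattice d).Walk u v, pathTime t p ≤ pathTime t p₀ → p.length < n := by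
    intro p hp
    have h1 := length_mul_le_pathTime ht p
    rw [div_lt_iff₀ ha] at hn
    have : a * p.length < a * n := by linarith
    exact_mod_cast lt_of_mul_lt_mul_left this ha.le
  have hfin : {p : (lattice d).Walk u v | p.length < n}.Finite := Set.toFinite _
  obtain ⟨p, hp, hmin⟩ := Set.exists_min_image _ (fun p => pathTime t p) hfin
    ⟨p₀, hn' p₀ le_rfl⟩
  have hle : ∀ q : (lattice d).Walk u v, pathTime t p ≤ pathTime t q := by
    intro q
    by_cases hq : q.length < n
    · exact hmin q hq
    · have h1 := hmin p₀ (hn' p₀ le_rfl)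
      have h2 : ¬ pathTime t q ≤ pathTime t p₀ := fun h => hq (hn' q h)
      linarith
  have hgeo : pathTime t p = passageTime t u v :=
    le_antisymm (le_ciInf hle) (passageTime_le ht0 p)
  refine ⟨p.bypass, ?_, p.bypass_isPath⟩
  exact le_antisymm (hgeo ▸ pathTime_bypass_le ht0 p) (passageTime_le ht0 _)

lemma mem_geodesic {e : Edge d} :
    e ∈ geodesic t u v ↔ ∃ p : (lattice d).Walk u v, IsGeodesic t p ∧ e ∈ edgeList p := by
  simp [geodesic, mem_edgeList]

/-- A geodesic that is a path crosses `e` at most once, so it stays a competitor whose cost grows by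
at most `s - t e`. -/
lemma passageTime_update_le_add {a : ℝ} (ha : 0 < a) (ht : ∀ e, a ≤ t e) (u v : Fin d → ℤ)
    (e : Edge d) {s : ℝ} (hs : t e ≤ s) :
    passageTime (Function.update t e s) u v ≤ passageTime t u v + (s - t e) := by
  obtain ⟨p, hp, hpath⟩ := exists_isGeodesic_isPath ha ht u v
  have h0 : ∀ e', 0 ≤ Function.update t e s e' := by
    intro e'
    by_cases h : e' = e
    · subst h; simpa using ha.le.trans ((ht _).trans hs)
    · simpa [h] using ha.le.trans (ht e')
  refine (passageTime_le h0 p).trans ?_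
  rw [pathTime_update, hp]
  have : (edgeList p).count e ≤ 1 := List.nodup_iff_count_le_one.1 (nodup_edgeList hpath) e
  have h1 : ((edgeList p).count e : ℝ) ≤ 1 := by exact_mod_cast this
  nlinarith

/-- Some geodesic avoids `e`, and its cost does not change when `t e` is raised. -/
lemma passageTime_update_le_of_notMem {a : ℝ} (ha : 0 < a) (ht : ∀ e, a ≤ t e)
    {e : Edge d} (he : e ∉ geodesic t u v) {s : ℝ} (hs : t e ≤ s) :
    passageTime (Function.update t e s) u v ≤ passageTime t u v := by
  obtain ⟨p, hp, -⟩ := exists_isGeodesic_isPath ha ht u v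
  have h0 : ∀ e', 0 ≤ Function.update t e s e' := by
    intro e'
    by_cases h : e' = e
    · subst h; simpa using ha.le.trans ((ht _).trans hs)
    · simpa [h] using ha.le.trans (ht e')
  have hnot : e ∉ edgeList p := fun h => he (mem_geodesic.2 ⟨p, hp, h⟩)
  refine (passageTime_le h0 p).trans ?_
  rw [pathTime_update, hp, count_edgeList_of_notMem hnot]
  simp

lemma passageTime_update_le_sub (ht : ∀ e, 0 ≤ t e)
    {e : Edge d} (he : e ∈ geodesic t u v) {s : ℝ} (hs0 : 0 ≤ s) (hs : s ≤ t e) :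
    passageTime (Function.update t e s) u v ≤ passageTime t u v - (t e - s) := by
  obtain ⟨p, hp, hep⟩ := mem_geodesic.1 he
  have h0 : ∀ e', 0 ≤ Function.update t e s e' := by
    intro e'
    by_cases h : e' = e
    · subst h; simpa using hs0
    · simpa [h] using ht e'
  refine (passageTime_le h0 p).trans ?_
  rw [pathTime_update, hp]
  have : 1 ≤ (edgeList p).count e := List.one_le_count_iff.2 hep
  have h1 : (1 : ℝ) ≤ (edgeList p).count e := by exact_mod_cast this
  nlinarith

/-- Raising the weight of an edge of a geodesic, from a value below the current one. -/
lemma add_min_le_passageTime_update {a : ℝ} (ha : 0 < a) (ht : ∀ e, a ≤ t e)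
    {e : Edge d} (he : e ∈ geodesic t u v) {s s' : ℝ} (has : a ≤ s) (hs : s ≤ t e) (hss' : s ≤ s') :
    passageTime (Function.update t e s) u v + min (t e - s) (s' - s) ≤
      passageTime (Function.update t e s') u v := by
  have ht0 : ∀ e, 0 ≤ t e := fun e => ha.le.trans (ht e)
  have h1 := passageTime_update_le_sub ht0 he (ha.le.trans has) hs
  have has' : ∀ e', a ≤ Function.update t e s' e' := by
    intro e'
    by_cases h : e' = e
    · subst h; simpa using has.trans hss'
    · simpa [h] using ht e'
  -- Lowering `t e` to `s` gains at least `t e - s`. If `s'` exceeds `t e`, monotonicity suffices;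
  -- otherwise lowering `t e` only to `s'` gains at most `t e - s'`, leaving a gap of `s' - s`.
  rcases le_total (t e) s' with h | h
  · have h2 : passageTime t u v ≤ passageTime (Function.update t e s') u v := by
      refine passageTime_mono ht0 (fun e' => ?_) u v
      by_cases h' : e' = e
      · subst h'; simpa using h
      · simp [h']
    have := min_le_left (t e - s) (s' - s)
    linarith
  · have h2 := passageTime_update_le_add ha has' u v e (s := t e) (by simpa using h)
    simp only [Function.update_idem, Function.update_eq_self, Function.update_self] at h2
    have := min_le_right (t e - s) (s' - s)
    linarith

/-- The stretch of a geodesic between two of its vertices is no slower than a shortest lattice walk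
`r` joining them; its edges cost at least `a` each, those of `r` at most `b` each. -/
lemma mul_le_mul_l1_of_isGeodesic {a b : ℝ} (ha : 0 < a) (ht : ∀ e, a ≤ t e) (hb : ∀ e, t e ≤ b)
    {p : (lattice d).Walk u v} (hp : IsGeodesic t p) {i j : ℕ} (hij : i ≤ j) (hj : j ≤ p.length) :
    a * ((j - i : ℕ) : ℝ) ≤ b * l1 (p.getVert j - p.getVert i) := by
  have ht0 : ∀ e, 0 ≤ t e := fun e => ha.le.trans (ht e)
  obtain ⟨r, hr⟩ := exists_walk_length_eq (p.getVert i) (p.getVert j)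
  have h1 := passageTime_le ht0 ((p.take i).append (r.append (p.drop j)))
  rw [← hp, pathTime_append, pathTime_append] at h1
  have h2 : pathTime t p = pathTime t (p.take i) +
      ((((edgeList p).drop i).take (j - i)).map t).sum + pathTime t (p.drop j) := by
    rw [pathTime_eq_sum, pathTime_eq_sum, pathTime_eq_sum, edgeList_take, edgeList_drop,
      ← List.sum_append, ← List.sum_append, ← List.map_append, ← List.map_append]
    congr 2
    rw [List.append_assoc]
    have : (edgeList p).drop j = ((edgeList p).drop i).drop (j - i) := by
      rw [List.drop_drop]; congr 1; omega
    rw [this, List.take_append_drop, List.take_append_drop]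
  have h3 : a * ((j - i : ℕ) : ℝ) ≤ ((((edgeList p).drop i).take (j - i)).map t).sum := by
    have := List.card_nsmul_le_sum ((((edgeList p).drop i).take (j - i)).map t) a (by
      intro x hx
      obtain ⟨e, -, rfl⟩ := List.mem_map.1 hx
      exact ht e)
    simp only [List.length_map, List.length_take, List.length_drop, length_edgeList] at this
    rw [min_eq_left (by omega), nsmul_eq_mul] at this
    linarith
  have h4 : pathTime t r ≤ b * l1 (p.getVert j - p.getVert i) := by
    have := pathTime_mono hb r
    rwa [pathTime_const, hr, mul_comm] at this
  linarith

end passageTime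

/-! ### Balls, thickenings and the linear growth of geodesics in balls. -/

/-- The finite `ℓ¹` ball of radius `n` around `x`. -/
noncomputable def ball (x : Fin d → ℤ) (n : ℕ) : Finset (Fin d → ℤ) :=
  (finite_setOf_l1_sub_le x n).toFinset

@[simp] lemma mem_ball {x y : Fin d → ℤ} {n : ℕ} : y ∈ ball x n ↔ l1 (y - x) ≤ n := by
  simp [ball]

lemma card_ball_le (x : Fin d → ℤ) (n : ℕ) : (ball x n).card ≤ (2 * n + 1) ^ d := by
  have hsub : ball x n ⊆ Finset.Icc (x - fun _ => (n : ℤ)) (x + fun _ => (n : ℤ)) := by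
    intro y hy
    have : ∀ i, (y i - x i).natAbs ≤ n := fun i =>
      (Finset.single_le_sum (f := fun i => ((y - x) i).natAbs) (fun _ _ => Nat.zero_le _)
        (Finset.mem_univ i)).trans (mem_ball.1 hy)
    refine Finset.mem_Icc.2 ⟨fun i => ?_, fun i => ?_⟩ <;> have := this i <;> simp <;> omega
  refine (Finset.card_le_card hsub).trans ?_
  rw [Pi.card_Icc]
  simp only [Pi.sub_apply, Pi.add_apply, Int.card_Icc]
  refine (Finset.prod_le_pow_card _ _ (2 * n + 1) fun i _ => ?_).trans (by simp)
  omega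

/-- The `2d` unit vectors of the lattice. -/
def unitStep (s : Fin d × Bool) : Fin d → ℤ := Pi.single s.1 (if s.2 then 1 else -1)

lemma l1_unitStep (s : Fin d × Bool) : l1 (unitStep s) = 1 := by
  unfold l1 unitStep
  rw [Finset.sum_eq_single s.1]
  · cases s.2 <;> simp
  · intro j _ hj
    simp [hj]
  · simp

lemma exists_unitStep_of_l1_eq_one {x : Fin d → ℤ} (h : l1 x = 1) : ∃ s, x = unitStep s := by
  obtain ⟨i, hi⟩ : ∃ i, x i ≠ 0 := by
    by_contra! hc
    rw [show x = 0 from funext hc, l1_zero] at h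
    omega
  have h1 : (x i).natAbs + ∑ j ∈ Finset.univ.erase i, (x j).natAbs = 1 := by
    rw [Finset.add_sum_erase _ (fun j => (x j).natAbs) (Finset.mem_univ i)]; exact h
  have h2 : (x i).natAbs ≠ 0 := by simpa using hi
  have h3 : ∑ j ∈ Finset.univ.erase i, (x j).natAbs = 0 := by omega
  have h4 : ∀ j, j ≠ i → x j = 0 := fun j hj => by
    have := Finset.sum_eq_zero_iff.1 h3 j (by simp [hj])
    simpa using this
  have h5 : x i = 1 ∨ x i = -1 := by omega
  refine ⟨(i, decide (x i = 1)), funext fun j => ?_⟩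
  by_cases hj : j = i
  · subst hj
    rcases h5 with h5 | h5 <;> simp [unitStep, h5]
  · simp [unitStep, hj, h4 j hj]

/-- The edge from `x` in direction `s`. -/
def stepEdge (x : Fin d → ℤ) (s : Fin d × Bool) : Edge d :=
  ⟨s(x, x + unitStep s), by
    rw [SimpleGraph.mem_edgeSet, lattice_adj_iff, l1_sub_comm]
    simp [l1_unitStep]⟩

lemma exists_stepEdge_of_adj {x y : Fin d → ℤ} (h : (lattice d).Adj x y) :
    ∃ s, y = x + unitStep s := by
  obtain ⟨s, hs⟩ := exists_unitStep_of_l1_eq_one (lattice_adj_iff.1 h.symm)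
  exact ⟨s, by rw [← hs]; abel⟩

/-- An edge is near `z` if one of its endpoints is at distance at most `n` from `z`. -/
def Near (e : Edge d) (z : Fin d → ℤ) (n : ℕ) : Prop :=
  ∃ x ∈ (e : Sym2 (Fin d → ℤ)), l1 (x - z) ≤ n

/-- The finite set of edges with an endpoint in a ball. -/
noncomputable def edgeBall (z : Fin d → ℤ) (n : ℕ) : Finset (Edge d) :=
  (ball z n ×ˢ Finset.univ).image fun q => stepEdge q.1 q.2

lemma mem_edgeBall_of_near {e : Edge d} {z : Fin d → ℤ} {n : ℕ} (h : Near e z n) :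
    e ∈ edgeBall z n := by
  obtain ⟨x, hx, hxz⟩ := h
  obtain ⟨e, he⟩ := e
  obtain ⟨y, rfl⟩ := hx
  obtain ⟨s, hs : y = x + unitStep s⟩ := exists_stepEdge_of_adj he
  subst hs
  exact Finset.mem_image.2 ⟨(x, s), by simp [hxz], rfl⟩

lemma card_edgeBall_le (z : Fin d → ℤ) (n : ℕ) :
    (edgeBall z n).card ≤ (2 * n + 1) ^ d * (2 * d) := by
  refine Finset.card_image_le.trans ?_
  rw [Finset.card_product]
  refine Nat.mul_le_mul (card_ball_le z n) ?_
  simp [mul_comm]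

/-- A distinguished endpoint of an edge. -/
noncomputable def Edge.base (e : Edge d) : Fin d → ℤ := (Quot.out (e : Sym2 (Fin d → ℤ))).1

lemma Edge.base_mem (e : Edge d) : e.base ∈ (e : Sym2 (Fin d → ℤ)) := Sym2.out_fst_mem _

/-- The edges within distance `n` of a finite set of edges. -/
noncomputable def thickening (E : Finset (Edge d)) (n : ℕ) : Finset (Edge d) :=
  E.biUnion fun e => edgeBall e.base n

lemma card_thickening_le (E : Finset (Edge d)) (n : ℕ) :
    (thickening E n).card ≤ E.card * ((2 * n + 1) ^ d * (2 * d)) :=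
  Finset.card_biUnion_le_card_mul _ _ _ fun _ _ => card_edgeBall_le _ _

section walks

variable {u v : Fin d → ℤ}

lemma near_base_of_walk (p : (lattice d).Walk u v) {i j : ℕ} (hi : i < (edgeList p).length)
    (hj : j < (edgeList p).length) :
    Near (edgeList p)[j] (edgeList p)[i].base p.length := by
  have hb := (edgeList p)[i].base_mem
  rw [val_getElem_edgeList, Sym2.mem_iff] at hb
  have hi' : i < p.length := by simpa using hi
  have hj' : j < p.length := by simpa using hj
  refine ⟨p.getVert j, by rw [val_getElem_edgeList]; exact Sym2.mem_mk_left _ _, ?_⟩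
  have key : ∀ k, k ≤ p.length → l1 (p.getVert j - p.getVert k) ≤ p.length := by
    intro k hk
    rcases le_total k j with h | h
    · exact (l1_getVert_sub_le p h).trans (by omega)
    · rw [l1_sub_comm]
      exact (l1_getVert_sub_le p h).trans (by omega)
  rcases hb with hb | hb <;> rw [hb]
  · exact key _ (by omega)
  · exact key _ (by omega)

lemma mem_thickening_of_walk (p : (lattice d).Walk u v) {e e' : Edge d} {E : Finset (Edge d)}
    (he : e ∈ edgeList p) (heE : e ∈ E) (he' : e' ∈ edgeList p) : e' ∈ thickening E p.length := by
  obtain ⟨i, hi, rfl⟩ := List.getElem_of_mem he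
  obtain ⟨j, hj, rfl⟩ := List.getElem_of_mem he'
  exact Finset.mem_biUnion.2 ⟨_, heE, mem_edgeBall_of_near (near_base_of_walk p hi hj)⟩

/-- A geodesic has at most linearly many edges in a ball. -/
lemma card_edges_near_le {t : Edge d → ℝ} {a b : ℝ} (ha : 0 < a) (ht : ∀ e, a ≤ t e)
    (hb : ∀ e, t e ≤ b) (hab : a ≤ b) {p : (lattice d).Walk u v} (hp : IsGeodesic t p)
    (z : Fin d → ℤ) (n : ℕ) {S : Finset (Edge d)}
    (hS : ∀ e ∈ S, e ∈ edgeList p ∧ Near e z n) :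
    (S.card : ℝ) ≤ b / a * (2 * (n + 1)) + 1 := by
  have hb0 : 0 ≤ b := ha.le.trans hab
  -- Edges are indexed by their first vertex along `p`. The radius is `n + 1` because the endpoint
  -- close to `z` may be the second one.
  set I := (Finset.range p.length).filter fun i => l1 (p.getVert i - z) ≤ n + 1 with hI
  have hcard : S.card ≤ I.card := by
    refine Finset.card_le_card_of_injOn (fun e => (edgeList p).idxOf e) ?_ ?_
    · intro e he
      obtain ⟨hep, x, hx, hxz⟩ := hS e he
      have hlt : (edgeList p).idxOf e < (edgeList p).length := List.idxOf_lt_length_of_mem hep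
      have hlt' : (edgeList p).idxOf e < p.length := by simpa using hlt
      have hval := val_getElem_edgeList p hlt
      rw [List.getElem_idxOf hlt] at hval
      rw [hval, Sym2.mem_iff] at hx
      simp only [hI, Finset.coe_filter, Finset.mem_range, Set.mem_ofPred_eq]
      refine ⟨hlt', ?_⟩
      rcases hx with rfl | rfl
      · omega
      · have h1 := l1_getVert_sub_le p (Nat.le_succ ((edgeList p).idxOf e))
        rw [l1_sub_comm] at h1
        have h2 := l1_sub_le (p.getVert ((edgeList p).idxOf e))
          (p.getVert ((edgeList p).idxOf e + 1)) z
        simp only [Nat.succ_eq_add_one] at h1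
        omega
    · intro e he e' he' h
      exact (List.idxOf_inj (hS e he).1).1 h
  have hcard' : (S.card : ℝ) ≤ I.card := by exact_mod_cast hcard
  refine hcard'.trans ?_
  rcases I.eq_empty_or_nonempty with h | h
  · rw [h]
    simp only [Finset.card_empty, Nat.cast_zero]
    positivity
  have hmem : ∀ i ∈ I, i < p.length ∧ l1 (p.getVert i - z) ≤ n + 1 := fun i hi => by
    simpa [hI] using hi
  have hmin := hmem _ (I.min'_mem h)
  have hmax := hmem _ (I.max'_mem h)
  have hle : I.min' h ≤ I.max' h := I.min'_le_max' h
  have hsub : I ⊆ Finset.Icc (I.min' h) (I.max' h) := fun i hi =>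
    Finset.mem_Icc.2 ⟨I.min'_le i hi, I.le_max' i hi⟩
  have h1 := Finset.card_le_card hsub
  rw [Nat.card_Icc] at h1
  -- The first and last indices in `I` belong to vertices at distance at most `2(n+1)`, so the
  -- geodesic cannot run for long between them.
  have h2 := mul_le_mul_l1_of_isGeodesic ha ht hb hp hle hmax.1.le
  have h3 := l1_sub_le (p.getVert (I.max' h)) z (p.getVert (I.min' h))
  rw [l1_sub_comm z] at h3
  have h4 : l1 (p.getVert (I.max' h) - p.getVert (I.min' h)) ≤ 2 * (n + 1) := by omega
  have h5 : (l1 (p.getVert (I.max' h) - p.getVert (I.min' h)) : ℝ) ≤ 2 * (n + 1) := by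
    exact_mod_cast h4
  have h6 : (I.card : ℝ) ≤ (I.max' h - I.min' h : ℕ) + 1 := by
    have : I.card ≤ (I.max' h - I.min' h) + 1 := by omega
    exact_mod_cast this
  have h7 : ((I.max' h - I.min' h : ℕ) : ℝ) ≤ b / a * (2 * (n + 1)) := by
    rw [div_mul_eq_mul_div, le_div_iff₀ ha, mul_comm]
    exact h2.trans (mul_le_mul_of_nonneg_left h5 hb0)
  linarith

end walks

/-! ### Comparing all visits of a geodesic with visits to edges of high weight. -/

section windows

variable {α : Type*}

/-- If one predicate is at most twice as frequent as another in every window of length `R`, then it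
is at most four times as frequent in the whole list. -/
lemma countP_le_four_mul {P Q : α → Bool} {R : ℕ} (hR : 0 < R) (l : List α) (hl : R ≤ l.length)
    (h : ∀ k, k + R ≤ l.length → ((l.drop k).take R).countP P ≤ 2 * ((l.drop k).take R).countP Q) :
    l.countP P ≤ 4 * l.countP Q := by
  have hfull : ∀ m, m * R ≤ l.length → (l.take (m * R)).countP P ≤ 2 * (l.take (m * R)).countP Q := by
    intro m
    induction m with
    | zero => simp
    | succ m ih =>
      intro hm
      rw [Nat.succ_mul] at hm ⊢
      rw [List.take_add, List.countP_append, List.countP_append]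
      have := ih (by omega)
      have := h _ hm
      omega
  have h1 := hfull (l.length / R) (Nat.div_mul_le_self _ _)
  have hsplit : ∀ P : α → Bool, l.countP P =
      (l.take (l.length / R * R)).countP P + (l.drop (l.length / R * R)).countP P := fun P => by
    rw [← List.countP_append, List.take_append_drop]
  have hmod := Nat.div_add_mod' l.length R
  have hlt := Nat.mod_lt l.length hR
  -- The leftover shorter than `R` is covered by the last full window. It may overlap the earlier
  -- ones, which turns the factor two into four.
  have h2 := h (l.length - R) (by omega)
  rw [List.take_of_length_le (by simp; omega)] at h2
  have h3 : (l.drop (l.length / R * R)).countP P ≤ (l.drop (l.length - R)).countP P :=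
    ((List.drop_sublist_drop_left l (by omega))).countP_le
  have h4 := (List.drop_sublist (l.length - R) l).countP_le (p := Q)
  have h5 := (List.take_sublist (l.length / R * R) l).countP_le (p := Q)
  have h6 := hsplit P
  omega

end windows

section paths

/-- The edge lists of the walks of length `n` from `x`. -/
noncomputable def walkLists : ℕ → (Fin d → ℤ) → Finset (List (Edge d))
  | 0, _ => {[]}
  | n + 1, x => Finset.univ.biUnion fun s : Fin d × Bool =>
      (walkLists n (x + unitStep s)).image (List.cons (stepEdge x s))

lemma card_walkLists_le (n : ℕ) (x : Fin d → ℤ) : (walkLists n x).card ≤ (2 * d) ^ n := by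
  induction n generalizing x with
  | zero => simp [walkLists]
  | succ n ih =>
    refine (Finset.card_biUnion_le_card_mul _ _ ((2 * d) ^ n) fun s _ =>
      Finset.card_image_le.trans (ih _)).trans ?_
    simp only [Finset.card_univ, Fintype.card_prod, Fintype.card_fin, Fintype.card_bool]
    rw [pow_succ]
    exact le_of_eq (by ring)

lemma edgeList_mem_walkLists {u v : Fin d → ℤ} (p : (lattice d).Walk u v) :
    edgeList p ∈ walkLists p.length u := by
  induction p with
  | nil => simp [walkLists, edgeList]
  | cons h p ih =>
    obtain ⟨s, rfl⟩ := exists_stepEdge_of_adj h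
    simp only [walkLists, SimpleGraph.Walk.length_cons, Finset.mem_biUnion, Finset.mem_univ,
      true_and, Finset.mem_image]
    exact ⟨s, _, ih, rfl⟩

lemma length_of_mem_walkLists {n : ℕ} {x : Fin d → ℤ} {l : List (Edge d)}
    (h : l ∈ walkLists n x) : l.length = n := by
  induction n generalizing x l with
  | zero => simp_all [walkLists]
  | succ n ih =>
    simp only [walkLists, Finset.mem_biUnion, Finset.mem_univ, true_and, Finset.mem_image] at h
    obtain ⟨s, l', hl', rfl⟩ := h
    simp [ih hl']

/-- The environments in which some walk of length `R` started in the ball of radius `B` around the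
origin has at least half of its edges of weight below `c`. -/
def manyLowEdges (d B R : ℕ) (c : ℝ) : Set (Edge d → ℝ) :=
  {t | ∃ x ∈ ball (0 : Fin d → ℤ) B, ∃ l ∈ walkLists R x,
    R ≤ 2 * (l.toFinset.filter fun e => t e < c).card}

/-- Deterministic comparison: off the event `manyLowEdges`, a geodesic that visits `E` often also
visits often the high edges in the thickening of `E`. -/
lemma card_filter_le_four_mul {t : Edge d → ℝ} {a b c : ℝ} (ha : 0 < a) (ht : ∀ e, a ≤ t e)
    (hb : ∀ e, t e ≤ b) {v : Fin d → ℤ} {p : (lattice d).Walk 0 v}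
    (hp : IsGeodesic t p) (hpath : p.IsPath) {R B : ℕ} (hR : 0 < R) (hRv : R ≤ l1 v)
    (hB : b / a * l1 v ≤ B) (hgood : t ∉ manyLowEdges d B R c) (E : Finset (Edge d)) :
    (E.filter fun e => e ∈ edgeList p).card ≤
      4 * ((thickening E R).filter fun e => e ∈ edgeList p ∧ c ≤ t e).card := by
  have hnd := nodup_edgeList hpath
  have hlen : l1 v ≤ p.length := by
    have := l1_getVert_sub_le p (Nat.zero_le p.length)
    simpa using this
  have hlenB : p.length ≤ B := by
    have h1 := length_mul_le_pathTime ht p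
    have h2 := passageTime_le_mul_l1 (fun e => ha.le.trans (ht e)) hb 0 v
    rw [← hp] at h2
    rw [sub_zero] at h2
    have h3 : (p.length : ℝ) ≤ b / a * l1 v := by
      rw [div_mul_eq_mul_div, le_div_iff₀ ha]; linarith
    exact_mod_cast h3.trans hB
  have hcount : ∀ (S : Finset (Edge d)) (P : Edge d → Prop) [DecidablePred P],
      (S.filter fun e => e ∈ edgeList p ∧ P e).card =
        (edgeList p).countP fun e => decide (e ∈ S ∧ P e) := by
    intro S P _
    rw [List.countP_eq_length_filter, ← List.toFinset_card_of_nodup (hnd.filter _)]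
    congr 1
    ext e
    simp
    tauto
  have h1 := hcount E (fun _ => True)
  simp only [and_true] at h1
  rw [h1, hcount]
  refine countP_le_four_mul hR _ (by simpa using hRv.trans hlen) fun k hk => ?_
  rw [length_edgeList] at hk
  set q := (p.drop k).take R with hq
  have hqlen : q.length = R := by simp [hq]; omega
  have hqe : edgeList q = ((edgeList p).drop k).take R := by
    rw [hq, edgeList_take, edgeList_drop]
  rw [← hqe]
  have hqnd : (edgeList q).Nodup := by
    rw [hqe]; exact (hnd.sublist (List.drop_sublist _ _)).sublist (List.take_sublist _ _)
  -- A window that misses `E` contributes nothing. A window that meets `E` lies entirely in the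
  -- thickening, and off the bad event at least half of its `R` edges are high.
  by_cases hE : ∃ e ∈ edgeList q, e ∈ E
  · obtain ⟨e, heq, heE⟩ := hE
    have h2 : (edgeList q).countP (fun e => decide (e ∈ thickening E R ∧ c ≤ t e)) =
        (edgeList q).countP (fun e => decide (c ≤ t e)) := by
      refine List.countP_congr fun e' he' => ?_
      have := mem_thickening_of_walk q heq heE he'
      rw [hqlen] at this
      simp [this]
    have h3 : (edgeList q).countP (fun e => decide (e ∈ E)) ≤ R :=
      List.countP_le_length.trans (by rw [length_edgeList, hqlen])
    have h4 : (edgeList q).countP (fun e => decide (c ≤ t e)) +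
        ((edgeList q).toFinset.filter fun e => t e < c).card = R := by
      have : ((edgeList q).toFinset.filter fun e => t e < c).card =
          (edgeList q).countP (fun e => !decide (c ≤ t e)) := by
        rw [List.countP_eq_length_filter, ← List.toFinset_card_of_nodup (hqnd.filter _)]
        congr 1
        ext e
        simp
      have h5 := List.length_eq_countP_add_countP (l := edgeList q) fun e => decide (c ≤ t e)
      rw [length_edgeList, hqlen] at h5
      rw [this]
      refine Eq.trans ?_ h5.symm
      congr 1
      exact List.countP_congr fun e _ => by simp
    have h5 : ¬ R ≤ 2 * ((edgeList q).toFinset.filter fun e => t e < c).card := by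
      intro h
      refine hgood ⟨p.getVert k, ?_, edgeList q, ?_, h⟩
      · rw [mem_ball]
        have := l1_getVert_sub_le p (Nat.zero_le k)
        rw [SimpleGraph.Walk.getVert_zero] at this
        omega
      · have := edgeList_mem_walkLists q
        rwa [hqlen] at this
    rw [h2]
    omega
  · have : (edgeList q).countP (fun e => decide (e ∈ E)) = 0 := by
      rw [List.countP_eq_zero]
      intro e he
      simpa using fun h => hE ⟨e, he, h⟩
    rw [this]
    exact Nat.zero_le _

end paths

/-! ### The score function of one weight. -/

section score

variable {G : Measure ℝ} {a b α : ℝ}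

/-- The density enters the proof in only two ways: `G` has no atoms, and `G` dominates a multiple of
Lebesgue measure on `[a,b]`. -/
lemma IsAdmissibleWeight.exists_lower_bound (hG : IsAdmissibleWeight G) :
    ∃ a b α : ℝ, 0 < a ∧ a < b ∧ 0 < α ∧ (∀ᵐ x ∂G, x ∈ Set.Icc a b) ∧ G ≪ volume ∧
      ENNReal.ofReal α • (volume : Measure ℝ).restrict (Set.Icc a b) ≤ G := by
  obtain ⟨a, b, α, ha, hab, hα, hsupp, ρ, -, hGρ, hρα⟩ := hG
  refine ⟨a, b, α, ha, hab, hα, hsupp, ?_, ?_⟩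
  · rw [hGρ]; exact withDensity_absolutelyContinuous _ _
  · calc ENNReal.ofReal α • (volume : Measure ℝ).restrict (Set.Icc a b)
        = (volume.restrict (Set.Icc a b)).withDensity (fun _ => ENNReal.ofReal α) :=
          (withDensity_const _).symm
      _ ≤ (volume.restrict (Set.Icc a b)).withDensity ρ := withDensity_mono hρα
      _ = (volume.withDensity ρ).restrict (Set.Icc a b) :=
          (restrict_withDensity measurableSet_Icc _).symm
      _ ≤ volume.withDensity ρ := Measure.restrict_le_self
      _ = G := hGρ.symm

/-- A bounded function whose pairing with `g` in `L²(G)` is the increment of `g` between an interval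
at the bottom of `[a,b]` and an interval at its top. -/
lemma exists_score [IsProbabilityMeasure G] (hα : 0 < α)
    (hdens : ENNReal.ofReal α • (volume : Measure ℝ).restrict (Set.Icc a b) ≤ G) {η : ℝ}
    (hηab : η ≤ b - a) :
    ∃ s : ℝ → ℝ, Measurable s ∧ (∀ x, |s x| ≤ 1) ∧ ∀ g : ℝ → ℝ, Measurable g →
      (∃ M, ∀ x ∈ Set.Icc a b, |g x| ≤ M) →
      ∫ x, s x * g x ∂G = α * ∫ u in Set.Ioc a (a + η), (g (u + (b - a - η)) - g u) := by
  set ν := ENNReal.ofReal α • (volume : Measure ℝ).restrict (Set.Icc a b) with hν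
  have hνG : ν ≪ G := Measure.absolutelyContinuous_of_le hdens
  have hfin : IsFiniteMeasure ν := ⟨(hdens _).trans_lt (measure_lt_top G _)⟩
  -- Multiplication by `k` turns `G`-integrals into `ν`-integrals. The density is at most one almost
  -- everywhere since `ν ≤ G`; truncation makes the bound hold everywhere.
  set k : ℝ → ℝ := fun x => min (ν.rnDeriv G x).toReal 1 with hk
  have hkm : Measurable k := (Measure.measurable_rnDeriv ν G).ennreal_toReal.min measurable_const
  have hk_ae : k =ᵐ[G] fun x => (ν.rnDeriv G x).toReal := by
    filter_upwards [Measure.rnDeriv_le_one_of_le hdens] with x hx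
    exact min_eq_left (ENNReal.toReal_le_of_le_ofReal zero_le_one (by simpa using hx))
  have hk0 : ∀ x, 0 ≤ k x := fun x => le_min ENNReal.toReal_nonneg zero_le_one
  have hk1 : ∀ x, k x ≤ 1 := fun x => min_le_right _ _
  have hkint : ∀ f : ℝ → ℝ, ∫ x, k x * f x ∂G = ∫ x, f x ∂ν := by
    intro f
    rw [← integral_toReal_rnDeriv_mul hνG]
    exact integral_congr_ae (hk_ae.mono fun x hx => by simp only [hx])
  set I0 := Set.Ioc a (a + η) with hI0
  set I1 := Set.Ioc (b - η) b with hI1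
  -- The sign is `+1` on the top interval and `-1` on the bottom one; translation by `b - a - η`
  -- carries the latter onto the former.
  set σ : ℝ → ℝ := fun x => I1.indicator 1 x - I0.indicator 1 x with hσ
  have hσm : Measurable σ :=
    (measurable_one.indicator measurableSet_Ioc).sub (measurable_one.indicator measurableSet_Ioc)
  refine ⟨fun x => k x * σ x, hkm.mul hσm, fun x => ?_, fun g hg ⟨M, hM⟩ => ?_⟩
  · rw [abs_mul, abs_of_nonneg (hk0 x)]
    have : |σ x| ≤ 1 := by
      simp only [hσ, Set.indicator_apply, Pi.one_apply]
      split_ifs <;> simp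
    exact mul_le_one₀ (hk1 x) (abs_nonneg _) this
  · simp only [mul_assoc]
    rw [hkint, hν, integral_smul_measure, ENNReal.toReal_ofReal hα.le, smul_eq_mul]
    congr 1
    have hsub0 : I0 ⊆ Set.Icc a b := fun x hx => ⟨hx.1.le, hx.2.trans (by linarith)⟩
    have hsub1 : I1 ⊆ Set.Icc a b := fun x hx => ⟨by linarith [hx.1], hx.2⟩
    have hgI : IntegrableOn g (Set.Icc a b) := by
      refine Measure.integrableOn_of_bounded (M := M) (by simp) hg.aestronglyMeasurable ?_
      exact (ae_restrict_iff' measurableSet_Icc).2 (.of_forall hM)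
    have h0 := hgI.mono_set hsub0
    have h1 := hgI.mono_set hsub1
    have hpre : (fun u : ℝ => u + (b - a - η)) ⁻¹' I1 = I0 := by
      ext u
      simp only [hI0, hI1, Set.mem_preimage, Set.mem_Ioc]
      constructor <;> rintro ⟨h1, h2⟩ <;> constructor <;> linarith
    have hmp := measurePreserving_add_right (volume : Measure ℝ) (b - a - η)
    have hemb := (MeasurableEquiv.addRight (b - a - η)).measurableEmbedding
    have hshift : ∫ u in I0, g (u + (b - a - η)) = ∫ x in I1, g x := by
      rw [← hpre]
      exact hmp.setIntegral_preimage_emb hemb g I1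
    have h1' : IntegrableOn (fun u => g (u + (b - a - η))) I0 := by
      rw [← hpre]
      exact (hmp.integrableOn_comp_preimage hemb).2 h1
    rw [integral_sub h1' h0, hshift]
    have : ∀ x, σ x * g x = I1.indicator g x - I0.indicator g x := by
      intro x
      simp only [hσ, Set.indicator_apply, Pi.one_apply]
      split_ifs <;> simp
    simp only [this]
    rw [integral_sub, integral_indicator measurableSet_Ioc, integral_indicator measurableSet_Ioc,
      Measure.restrict_restrict measurableSet_Ioc, Measure.restrict_restrict measurableSet_Ioc,
      Set.inter_eq_left.2 hsub0, Set.inter_eq_left.2 hsub1]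
    · exact hgI.integrable.indicator measurableSet_Ioc
    · exact hgI.integrable.indicator measurableSet_Ioc

end score

/-! ### The product measure, resampling and uniqueness of geodesics. -/

section environment

variable {G : Measure ℝ} [IsProbabilityMeasure G] {a b : ℝ}

instance : IsProbabilityMeasure (envMeasure d G) := by unfold envMeasure; infer_instance

lemma measurable_update_prod (e : Edge d) :
    Measurable fun q : (Edge d → ℝ) × ℝ => Function.update q.1 e q.2 := by
  refine measurable_pi_lambda _ fun e' => ?_
  by_cases h : e' = e
  · subst h; simpa using measurable_snd
  · simpa [h, Function.comp_def] using (measurable_pi_apply e').comp measurable_fst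

/-- Resampling one weight preserves the law of the environment. -/
lemma map_update_envMeasure (e : Edge d) :
    ((envMeasure d G).prod G).map (fun q => Function.update q.1 e q.2) = envMeasure d G := by
  refine Measure.eq_infinitePi _ fun s t ht => ?_
  rw [Measure.map_apply (measurable_update_prod e)
    (.pi s.countable_toSet fun _ _ => ht _)]
  by_cases he : e ∈ s
  · have : (fun q : (Edge d → ℝ) × ℝ => Function.update q.1 e q.2) ⁻¹' ((s : Set (Edge d)).pi t) =
        (((s.erase e : Finset (Edge d)) : Set (Edge d)).pi t) ×ˢ t e := by
      ext ⟨x, u⟩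
      simp only [Set.mem_preimage, Set.mem_pi, Set.mem_prod, Finset.mem_coe, Finset.mem_erase]
      constructor
      · intro h
        refine ⟨fun i hi => ?_, by simpa using h e he⟩
        simpa [hi.1] using h i hi.2
      · rintro ⟨h1, h2⟩ i hi
        by_cases hie : i = e
        · subst hie; simpa using h2
        · simpa [hie] using h1 i ⟨hie, hi⟩
    rw [this, Measure.prod_prod, envMeasure, Measure.infinitePi_pi _ (fun i _ => ht i),
      Finset.prod_erase_mul _ _ he]
  · have : (fun q : (Edge d → ℝ) × ℝ => Function.update q.1 e q.2) ⁻¹' ((s : Set (Edge d)).pi t) =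
        ((s : Set (Edge d)).pi t) ×ˢ Set.univ := by
      ext ⟨x, u⟩
      simp only [Set.mem_preimage, Set.mem_pi, Set.mem_prod, Finset.mem_coe, Set.mem_univ, and_true]
      refine forall₂_congr fun i hi => ?_
      rw [Function.update_of_ne (by rintro rfl; exact he hi)]
    rw [this, Measure.prod_prod, envMeasure, Measure.infinitePi_pi _ (fun i _ => ht i)]
    simp

lemma ae_mem_Icc (hG : ∀ᵐ x ∂G, x ∈ Set.Icc a b) :
    ∀ᵐ t ∂envMeasure d G, ∀ e, t e ∈ Set.Icc a b := by
  rw [ae_all_iff]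
  intro e
  exact (measurePreserving_eval_infinitePi (fun _ : Edge d => G) e).quasiMeasurePreserving.ae hG

lemma measurable_pathTime {u v : Fin d → ℤ} (p : (lattice d).Walk u v) :
    Measurable fun t : Edge d → ℝ => pathTime t p := by
  simp only [pathTime_eq_sum]
  induction edgeList p with
  | nil => simp
  | cons e l ih =>
    simp only [List.map_cons, List.sum_cons]
    exact (measurable_pi_apply e).add ih

lemma measurable_passageTime (u v : Fin d → ℤ) :
    Measurable fun t : Edge d → ℝ => passageTime t u v :=
  Measurable.iInf fun p => measurable_pathTime p

lemma measurableSet_mem_geodesic (u v : Fin d → ℤ) (e : Edge d) :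
    MeasurableSet {t : Edge d → ℝ | e ∈ geodesic t u v} := by
  have : {t : Edge d → ℝ | e ∈ geodesic t u v} =
      ⋃ p : (lattice d).Walk u v, {t | IsGeodesic t p ∧ e ∈ edgeList p} := by
    ext t
    simp [mem_geodesic]
  rw [this]
  exact .iUnion fun p =>
    (measurableSet_eq_fun (measurable_pathTime p) (measurable_passageTime u v)).inter (.const _)

/-- Almost surely, all geodesics between two points use the same edges. -/
lemma ae_geodesic_unique (hG : G ≪ volume) (u v : Fin d → ℤ) :
    ∀ᵐ t ∂envMeasure d G, ∀ p q : (lattice d).Walk u v, IsGeodesic t p → IsGeodesic t q →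
      ∀ e, e ∈ edgeList p → e ∈ edgeList q := by
  rw [ae_all_iff]
  intro p
  rw [ae_all_iff]
  intro q
  by_cases hpq : ∀ e, e ∈ edgeList p → e ∈ edgeList q
  · exact .of_forall fun t _ _ => hpq
  push Not at hpq
  obtain ⟨e, hep, heq⟩ := hpq
  have hc : (1 : ℝ) ≤ (edgeList p).count e := by exact_mod_cast List.one_le_count_iff.2 hep
  have hc' := count_edgeList_of_notMem heq
  have hms : MeasurableSet {t : Edge d → ℝ | pathTime t p ≠ pathTime t q} :=
    (measurableSet_eq_fun (measurable_pathTime p) (measurable_pathTime q)).compl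
  -- With the other weights frozen, the difference of the two path times is affine in `t e` with
  -- nonzero slope, so it vanishes for one value of `t e` only, and `G` has no atoms.
  have key : ∀ᵐ t ∂envMeasure d G, pathTime t p ≠ pathTime t q := by
    rw [← map_update_envMeasure e, ae_map_iff (measurable_update_prod e).aemeasurable hms]
    refine (Measure.ae_prod_iff_ae_ae (measurable_update_prod e hms)).2 (.of_forall fun t => ?_)
    have h0 : G {t e - (pathTime t p - pathTime t q) / (edgeList p).count e} = 0 :=
      hG Real.volume_singleton
    filter_upwards [compl_mem_ae_iff.2 h0] with x hx heq'
    refine hx ?_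
    rw [pathTime_update, pathTime_update, hc', Nat.cast_zero, zero_mul, add_zero] at heq'
    rw [Set.mem_singleton_iff]
    field_simp
    linarith
  filter_upwards [key] with t ht hp hq
  exact absurd (hp.trans hq.symm) ht

/-! ### Pairing scores with passage times. -/

variable {α η : ℝ} {s : ℝ → ℝ}

lemma update_mem_Icc {t : Edge d → ℝ} (ht : ∀ e, t e ∈ Set.Icc a b) (e : Edge d) {x : ℝ}
    (hx : x ∈ Set.Icc a b) : ∀ e', Function.update t e x e' ∈ Set.Icc a b := by
  intro e'
  by_cases h : e' = e
  · subst h; simpa using hx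
  · simpa [h] using ht e'

/-- The characteristic property of a score: pairing with it is a difference operator. -/
def IsScore (G : Measure ℝ) (a b α η : ℝ) (s : ℝ → ℝ) : Prop :=
  Measurable s ∧ (∀ x, |s x| ≤ 1) ∧ ∀ g : ℝ → ℝ, Measurable g →
    (∃ M, ∀ x ∈ Set.Icc a b, |g x| ≤ M) →
    ∫ x, s x * g x ∂G = α * ∫ u in Set.Ioc a (a + η), (g (u + (b - a - η)) - g u)

lemma integrable_of_bounded_on_Icc (hsupp : ∀ᵐ x ∂G, x ∈ Set.Icc a b) {F : (Edge d → ℝ) → ℝ}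
    (hF : Measurable F) {M : ℝ} (hM : ∀ t : Edge d → ℝ, (∀ e, t e ∈ Set.Icc a b) → |F t| ≤ M) :
    Integrable F (envMeasure d G) :=
  .of_bound hF.aestronglyMeasurable M ((ae_mem_Icc hsupp).mono fun t ht => hM t ht)

lemma integrable_score_mul (hs : IsScore G a b α η s) (hsupp : ∀ᵐ x ∂G, x ∈ Set.Icc a b)
    {F : (Edge d → ℝ) → ℝ}
    (hF : Measurable F) {M : ℝ} (hM : ∀ t : Edge d → ℝ, (∀ e, t e ∈ Set.Icc a b) → |F t| ≤ M)
    (e : Edge d) : Integrable (fun t => s (t e) * F t) (envMeasure d G) := by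
  refine integrable_of_bounded_on_Icc hsupp ((hs.1.comp (measurable_pi_apply e)).mul hF)
    (M := M) fun t ht => ?_
  rw [abs_mul]
  exact (mul_le_of_le_one_left (abs_nonneg _) (hs.2.1 _)).trans (hM t ht)

/-- Resample the weight of `e` and apply the score identity in the fresh variable, the other weights
being fixed. -/
lemma integral_score_mul (hs : IsScore G a b α η s) (hsupp : ∀ᵐ x ∂G, x ∈ Set.Icc a b)
    {F : (Edge d → ℝ) → ℝ} (hF : Measurable F) {M : ℝ}
    (hM : ∀ t : Edge d → ℝ, (∀ e, t e ∈ Set.Icc a b) → |F t| ≤ M) (e : Edge d) :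
    ∫ t, s (t e) * F t ∂envMeasure d G =
      α * ∫ t, (∫ u in Set.Ioc a (a + η), (F (Function.update t e (u + (b - a - η))) -
        F (Function.update t e u))) ∂envMeasure d G := by
  have hint := integrable_score_mul hs hsupp hF hM e
  have hm := measurable_update_prod e
  have hmeas : Measurable fun t : Edge d → ℝ => s (t e) * F t :=
    (hs.1.comp (measurable_pi_apply e)).mul hF
  conv_lhs => rw [← map_update_envMeasure e]
  rw [integral_map hm.aemeasurable hmeas.aestronglyMeasurable, integral_prod, ← integral_const_mul]
  · refine integral_congr_ae ((ae_mem_Icc hsupp).mono fun t ht => ?_)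
    simp only [Function.update_self]
    exact hs.2.2 (fun x => F (Function.update t e x))
      (hF.comp (hm.comp measurable_prodMk_left)) ⟨M, fun x hx => hM _ (update_mem_Icc ht e hx)⟩
  · rw [← map_update_envMeasure e] at hint
    exact hint.comp_measurable hm

lemma abs_passageTime_le {t : Edge d → ℝ} (ha : 0 < a) (ht : ∀ e, t e ∈ Set.Icc a b)
    (x y : Fin d → ℤ) : |passageTime t x y| ≤ b * l1 (y - x) := by
  have h0 : ∀ e, 0 ≤ t e := fun e => ha.le.trans (ht e).1
  rw [abs_of_nonneg (passageTime_nonneg h0 _ _)]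
  exact passageTime_le_mul_l1 h0 (fun e => (ht e).2) _ _

lemma passageTime_increment_nonneg (ha : 0 < a) (hη : 0 < η) (hηab : 2 * η ≤ b - a)
    {t : Edge d → ℝ} (ht : ∀ e, t e ∈ Set.Icc a b) (x y : Fin d → ℤ) (e : Edge d)
    {u : ℝ} (hu : u ∈ Set.Ioc a (a + η)) :
    0 ≤ passageTime (Function.update t e (u + (b - a - η))) x y -
      passageTime (Function.update t e u) x y := by
  rw [sub_nonneg]
  refine passageTime_mono (fun e' => ha.le.trans (update_mem_Icc ht e
    (x := u) ⟨hu.1.le, by linarith [hu.2]⟩ e').1) (fun e' => ?_) x y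
  by_cases h : e' = e
  · subst h; simp; linarith
  · simp [h]

/-- If `e` lies on no geodesic at the low value `u`, raising its weight changes nothing; otherwise
the increment is at most the raise. -/
lemma passageTime_increment_le (ha : 0 < a) (hη : 0 < η) (hηab : 2 * η ≤ b - a)
    {t : Edge d → ℝ} (ht : ∀ e, t e ∈ Set.Icc a b) (x y : Fin d → ℤ) (e : Edge d)
    {u : ℝ} (hu : u ∈ Set.Ioc a (a + η)) :
    passageTime (Function.update t e (u + (b - a - η))) x y -
      passageTime (Function.update t e u) x y ≤
      (b - a) * {t : Edge d → ℝ | e ∈ geodesic t x y}.indicator 1 (Function.update t e u) := by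
  have hlow : ∀ e', a ≤ Function.update t e u e' := fun e' =>
    (update_mem_Icc ht e (x := u) ⟨hu.1.le, by linarith [hu.2]⟩ e').1
  by_cases he : e ∈ geodesic (Function.update t e u) x y
  · rw [Set.indicator_of_mem (by exact he)]
    have := passageTime_update_le_add ha hlow x y e (s := u + (b - a - η)) (by simp; linarith)
    simp only [Function.update_idem, Function.update_self] at this
    simp only [Pi.one_apply, mul_one]
    linarith
  · rw [Set.indicator_of_notMem (by exact he)]
    have := passageTime_update_le_of_notMem ha hlow he (s := u + (b - a - η)) (by simp; linarith)
    simp only [Function.update_idem] at this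
    linarith

/-- Membership is assumed for the original weight `t e`, at least `η` above `u`. Hence `e` stays on
a geodesic up to that level, and the passage time grows by at least `η` along the raise. -/
lemma passageTime_increment_le_of_mem (ha : 0 < a) (hη : 0 < η) (hηab : 2 * η ≤ b - a)
    {t : Edge d → ℝ} (ht : ∀ e, t e ∈ Set.Icc a b) (x y : Fin d → ℤ) (e : Edge d)
    (he : e ∈ geodesic t x y) (hhigh : a + 2 * η ≤ t e) {u : ℝ}
    (hu : u ∈ Set.Ioc a (a + η)) :
    η ≤ passageTime (Function.update t e (u + (b - a - η))) x y -
      passageTime (Function.update t e u) x y := by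
  have h1 := add_min_le_passageTime_update ha (fun e => (ht e).1) he (s := u)
    (s' := u + (b - a - η)) hu.1.le (by linarith [hu.2]) (by linarith)
  have h2 : η ≤ min (t e - u) (u + (b - a - η) - u) :=
    le_min (by linarith [hu.2]) (by linarith)
  linarith

lemma abs_passageTime_increment_le (ha : 0 < a) (hη : 0 < η) (hηab : 2 * η ≤ b - a)
    {t : Edge d → ℝ} (ht : ∀ e, t e ∈ Set.Icc a b) (x y : Fin d → ℤ) (e : Edge d)
    {u : ℝ} (hu : u ∈ Set.Ioc a (a + η)) :
    |passageTime (Function.update t e (u + (b - a - η))) x y -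
      passageTime (Function.update t e u) x y| ≤ b - a := by
  rw [abs_of_nonneg (passageTime_increment_nonneg ha hη hηab ht x y e hu)]
  refine (passageTime_increment_le ha hη hηab ht x y e hu).trans ?_
  refine mul_le_of_le_one_right (by linarith) ?_
  exact Set.indicator_le_self' (f := fun _ => (1 : ℝ)) (fun _ _ => zero_le_one) _

lemma measurable_passageTime_increment (x y : Fin d → ℤ) (e : Edge d) (ℓ : ℝ) :
    Measurable fun q : (Edge d → ℝ) × ℝ => passageTime (Function.update q.1 e (q.2 + ℓ)) x y -
      passageTime (Function.update q.1 e q.2) x y :=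
  have hm := measurable_update_prod e
  (((measurable_passageTime x y).comp
    (hm.comp (measurable_fst.prodMk (measurable_snd.add_const _))))).sub
    ((measurable_passageTime x y).comp hm)

lemma integrableOn_passageTime_increment (ha : 0 < a) (hη : 0 < η) (hηab : 2 * η ≤ b - a)
    {t : Edge d → ℝ} (ht : ∀ e, t e ∈ Set.Icc a b) (x y : Fin d → ℤ) (e : Edge d) :
    IntegrableOn (fun u => passageTime (Function.update t e (u + (b - a - η))) x y -
        passageTime (Function.update t e u) x y) (Set.Ioc a (a + η)) := by
  refine Measure.integrableOn_of_bounded (M := b - a) (by simp)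
    ((measurable_passageTime_increment x y e _).comp measurable_prodMk_left).aestronglyMeasurable ?_
  exact (ae_restrict_iff' measurableSet_Ioc).2
    (.of_forall fun u hu => abs_passageTime_increment_le ha hη hηab ht x y e hu)

/-- Lower bound on the pairing of the score with a passage time. -/
lemma le_integral_score_mul_passageTime (ha : 0 < a) (hα : 0 ≤ α) (hη : 0 < η) (hηab : 2 * η ≤ b - a)
    (hs : IsScore G a b α η s) (hsupp : ∀ᵐ x ∂G, x ∈ Set.Icc a b) (x y : Fin d → ℤ) (e : Edge d) :
    α * η ^ 2 * (envMeasure d G).real {t | e ∈ geodesic t x y ∧ a + 2 * η ≤ t e} ≤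
      ∫ t, s (t e) * passageTime t x y ∂envMeasure d G := by
  rw [integral_score_mul hs hsupp (measurable_passageTime x y)
    (fun t ht => abs_passageTime_le ha ht x y), mul_assoc]
  refine mul_le_mul_of_nonneg_left ?_ hα
  set A := {t : Edge d → ℝ | e ∈ geodesic t x y ∧ a + 2 * η ≤ t e} with hA
  have hAm : MeasurableSet A := (measurableSet_mem_geodesic x y e).inter
    (measurableSet_le measurable_const (measurable_pi_apply e))
  have hIc : ∀ c : ℝ, ∫ _ in Set.Ioc a (a + η), c = η * c := fun c => by
    simp [hη.le]
  rw [mul_comm, ← smul_eq_mul, ← integral_indicator_const _ hAm]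
  refine integral_mono_ae ((integrable_const _).indicator hAm) ?_ ?_
  · refine integrable_of_bounded_on_Icc hsupp
      ((measurable_passageTime_increment x y e _).stronglyMeasurable.integral_prod_right').measurable
      (M := η * (b - a)) ?_
    intro t ht
    refine (norm_setIntegral_le_of_norm_le_const (μ := (volume : Measure ℝ))
      (f := fun u => passageTime (Function.update t e (u + (b - a - η))) x y -
        passageTime (Function.update t e u) x y)
      (s := Set.Ioc a (a + η)) (C := b - a) measure_Ioc_lt_top
      (fun u hu => ?_)).trans (le_of_eq ?_)
    · exact abs_passageTime_increment_le ha hη hηab ht x y e hu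
    · simp [hη.le, mul_comm]
  · filter_upwards [ae_mem_Icc hsupp] with t ht
    by_cases htA : t ∈ A
    · rw [Set.indicator_of_mem htA, pow_two, ← hIc η]
      exact setIntegral_mono_on (integrableOn_const (by simp))
        (integrableOn_passageTime_increment ha hη hηab ht x y e) measurableSet_Ioc fun u hu =>
        passageTime_increment_le_of_mem ha hη hηab ht x y e htA.1 htA.2 hu
    · rw [Set.indicator_of_notMem htA]
      exact setIntegral_nonneg measurableSet_Ioc fun u hu =>
        passageTime_increment_nonneg ha hη hηab ht x y e hu

/-- Upper bound on the pairing of the score with a passage time. -/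
lemma integral_score_mul_passageTime_le (ha : 0 < a) (hα : 0 < α) (hη : 0 < η)
    (hηab : 2 * η ≤ b - a)
    (hdens : ENNReal.ofReal α • (volume : Measure ℝ).restrict (Set.Icc a b) ≤ G)
    (hs : IsScore G a b α η s) (hsupp : ∀ᵐ x ∂G, x ∈ Set.Icc a b) (x y : Fin d → ℤ) (e : Edge d) :
    ∫ t, s (t e) * passageTime t x y ∂envMeasure d G ≤
      (b - a) * (envMeasure d G).real {t | e ∈ geodesic t x y} := by
  have hm := measurable_update_prod e
  set A := {t : Edge d → ℝ | e ∈ geodesic t x y} with hA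
  have hAm : MeasurableSet A := measurableSet_mem_geodesic x y e
  have hind : Measurable (A.indicator (1 : (Edge d → ℝ) → ℝ)) := measurable_one.indicator hAm
  have hind0 : ∀ t, 0 ≤ A.indicator (1 : (Edge d → ℝ) → ℝ) t :=
    fun t => Set.indicator_nonneg (fun _ _ => zero_le_one) t
  have hind1 : ∀ t, A.indicator (1 : (Edge d → ℝ) → ℝ) t ≤ 1 :=
    fun t => Set.indicator_le_self' (f := fun _ => (1 : ℝ)) (fun _ _ => zero_le_one) t
  have hindInt : Integrable
      (fun q => A.indicator (1 : (Edge d → ℝ) → ℝ) (Function.update q.1 e q.2))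
      ((envMeasure d G).prod G) := by
    refine .of_bound (hind.comp hm).aestronglyMeasurable 1 (.of_forall fun q => ?_)
    rw [Real.norm_eq_abs, abs_of_nonneg (hind0 _)]
    exact hind1 _
  have hindInt' : ∀ (t : Edge d → ℝ) (μ : Measure ℝ) [IsFiniteMeasure μ],
      Integrable (fun u => A.indicator (1 : (Edge d → ℝ) → ℝ) (Function.update t e u)) μ := by
    intro t μ _
    refine .of_bound ((hind.comp hm).comp measurable_prodMk_left).aestronglyMeasurable 1
      (.of_forall fun q => ?_)
    rw [Real.norm_eq_abs, abs_of_nonneg (hind0 _)]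
    exact hind1 _
  have hreal : (envMeasure d G).real A = ∫ t, (∫ u, A.indicator (1 : (Edge d → ℝ) → ℝ)
      (Function.update t e u) ∂G) ∂envMeasure d G := by
    rw [← integral_indicator_one hAm, ← integral_prod _ hindInt]
    conv_lhs => rw [← map_update_envMeasure e]
    rw [integral_map hm.aemeasurable hind.aestronglyMeasurable]
  rw [integral_score_mul hs hsupp (measurable_passageTime x y)
    (fun t ht => abs_passageTime_le ha ht x y), hreal, ← integral_const_mul, ← integral_const_mul]
  refine integral_mono_of_nonneg ?_ (hindInt.integral_prod_left.const_mul _) ?_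
  · filter_upwards [ae_mem_Icc hsupp] with t ht
    exact mul_nonneg hα.le (setIntegral_nonneg measurableSet_Ioc fun u hu =>
      passageTime_increment_nonneg ha hη hηab ht x y e hu)
  · filter_upwards [ae_mem_Icc hsupp] with t ht
    have hba : 0 ≤ b - a := by linarith
    have h1 : ∫ u in Set.Ioc a (a + η), (passageTime (Function.update t e (u + (b - a - η))) x y -
        passageTime (Function.update t e u) x y) ≤
        ∫ u in Set.Ioc a (a + η), (b - a) * A.indicator 1 (Function.update t e u) :=
      setIntegral_mono_on (integrableOn_passageTime_increment ha hη hηab ht x y e)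
        ((hindInt' t _).const_mul _) measurableSet_Ioc fun u hu =>
        passageTime_increment_le ha hη hηab ht x y e hu
    have h2 : ∫ u in Set.Ioc a (a + η), A.indicator (1 : (Edge d → ℝ) → ℝ) (Function.update t e u) ≤
        ∫ u in Set.Icc a b, A.indicator (1 : (Edge d → ℝ) → ℝ) (Function.update t e u) := by
      refine setIntegral_mono_set (hindInt' t _) (.of_forall fun u => hind0 _) ?_
      exact (show Set.Ioc a (a + η) ⊆ Set.Icc a b from
        fun u hu => ⟨hu.1.le, by linarith [hu.2]⟩).eventuallyLE
    -- Domination of `α` times Lebesgue measure by `G` turns the integral over `u` into a resampling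
    -- of `t e`, hence into the probability in `hreal`.
    have h3 : α * ∫ u in Set.Icc a b, A.indicator (1 : (Edge d → ℝ) → ℝ) (Function.update t e u) ≤
        ∫ u, A.indicator (1 : (Edge d → ℝ) → ℝ) (Function.update t e u) ∂G := by
      have := integral_mono_measure hdens (.of_forall fun u => hind0 (Function.update t e u))
        (hindInt' t G)
      rwa [integral_smul_measure, ENNReal.toReal_ofReal hα.le, smul_eq_mul] at this
    rw [integral_const_mul] at h1
    calc _ ≤ α * ((b - a) * ∫ u in Set.Ioc a (a + η), A.indicator 1 (Function.update t e u)) :=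
          mul_le_mul_of_nonneg_left h1 hα.le
      _ ≤ α * ((b - a) * ∫ u in Set.Icc a b, A.indicator 1 (Function.update t e u)) := by gcongr
      _ = (b - a) * (α * ∫ u in Set.Icc a b, A.indicator 1 (Function.update t e u)) := by ring
      _ ≤ _ := by gcongr

/-- Scores of distinct edges are orthogonal. -/
lemma integral_score_mul_score (hs : IsScore G a b α η s) (hsupp : ∀ᵐ x ∂G, x ∈ Set.Icc a b)
    {e e' : Edge d} (h : e ≠ e') :
    ∫ t, s (t e) * s (t e') ∂envMeasure d G = 0 := by
  -- The factor `s (t e')` does not depend on `t e`, so its increments vanish.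
  rw [integral_score_mul hs hsupp (F := fun t => s (t e')) (hs.1.comp (measurable_pi_apply e'))
    (fun t _ => hs.2.1 _)]
  simp [Function.update_of_ne h.symm]

/-- By orthogonality only the diagonal terms remain, each at most one. -/
lemma integral_sum_score_sq_le (hs : IsScore G a b α η s) (hsupp : ∀ᵐ x ∂G, x ∈ Set.Icc a b)
    (U : Finset (Edge d)) :
    ∫ t, (∑ e ∈ U, s (t e)) ^ 2 ∂envMeasure d G ≤ U.card := by
  have hint : ∀ e e' : Edge d, Integrable (fun t => s (t e) * s (t e')) (envMeasure d G) :=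
    fun e e' => integrable_score_mul hs hsupp (F := fun t => s (t e'))
      (hs.1.comp (measurable_pi_apply e')) (fun t _ => hs.2.1 _) e
  simp only [pow_two, Finset.sum_mul_sum]
  rw [integral_finsetSum _ fun e _ => integrable_finsetSum _ fun e' _ => hint e e']
  have : ∀ e ∈ U, ∫ t, ∑ e' ∈ U, s (t e) * s (t e') ∂envMeasure d G ≤ 1 := by
    intro e he
    rw [integral_finsetSum _ fun e' _ => hint e e', Finset.sum_eq_single_of_mem e he
      fun e' _ h => integral_score_mul_score hs hsupp h.symm]
    calc _ ≤ ∫ _, (1 : ℝ) ∂envMeasure d G := by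
          refine integral_mono (hint e e) (integrable_const _) fun t => ?_
          have := hs.2.1 (t e)
          rw [← abs_mul_abs_self]
          exact mul_le_one₀ this (abs_nonneg _) this
      _ = 1 := by simp
  calc _ ≤ ∑ e ∈ U, (1 : ℝ) := Finset.sum_le_sum this
    _ = _ := by simp

/-- Square-root cancellation in the pairing of a bounded function with a sum of scores. -/
lemma sum_integral_score_mul_le (hs : IsScore G a b α η s) (hsupp : ∀ᵐ x ∂G, x ∈ Set.Icc a b)
    {F : (Edge d → ℝ) → ℝ} (hF : Measurable F) {M : ℝ} (hM0 : 0 ≤ M)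
    (hM : ∀ t : Edge d → ℝ, (∀ e, t e ∈ Set.Icc a b) → |F t| ≤ M) (U : Finset (Edge d)) :
    ∑ e ∈ U, ∫ t, s (t e) * F t ∂envMeasure d G ≤ M * √U.card := by
  rcases U.eq_empty_or_nonempty with rfl | hU
  · simp
  rw [← integral_finsetSum _ fun e _ => integrable_score_mul hs hsupp hF hM e]
  simp only [← Finset.sum_mul]
  set c := √(U.card : ℝ) with hc
  have hc0 : 0 < c := Real.sqrt_pos.2 (by exact_mod_cast hU.card_pos)
  have hcc : c ^ 2 = U.card := Real.sq_sqrt (by positivity)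
  have hSm : Measurable fun t : Edge d → ℝ => ∑ e ∈ U, s (t e) :=
    Finset.measurable_sum _ fun e _ => hs.1.comp (measurable_pi_apply e)
  have hSb : ∀ t : Edge d → ℝ, |∑ e ∈ U, s (t e)| ≤ U.card := fun t =>
    (Finset.abs_sum_le_sum_abs _ _).trans
      ((Finset.sum_le_sum fun e _ => hs.2.1 (t e)).trans (by simp))
  have hS2 : Integrable (fun t : Edge d → ℝ => (∑ e ∈ U, s (t e)) ^ 2) (envMeasure d G) := by
    refine .of_bound (hSm.pow_const 2).aestronglyMeasurable ((U.card : ℝ) ^ 2)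
      (.of_forall fun t => ?_)
    rw [norm_pow]
    exact pow_le_pow_left₀ (abs_nonneg _) (hSb t) 2
  -- In place of the Cauchy–Schwarz inequality: `2 c x ≤ x ^ 2 + c ^ 2`, with `c` equal to the bound
  -- `√|U|` on the `L²` norm of the sum of scores.
  have hbound : ∀ᵐ t ∂envMeasure d G, (∑ e ∈ U, s (t e)) * F t ≤
      M / (2 * c) * ((∑ e ∈ U, s (t e)) ^ 2 + c ^ 2) := by
    filter_upwards [ae_mem_Icc hsupp] with t ht
    have h1 : (∑ e ∈ U, s (t e)) * F t ≤ |∑ e ∈ U, s (t e)| * M :=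
      (le_abs_self _).trans (by rw [abs_mul]; exact mul_le_mul_of_nonneg_left (hM t ht) (abs_nonneg _))
    refine h1.trans ?_
    rw [div_mul_eq_mul_div, le_div_iff₀ (by positivity), ← sq_abs (∑ e ∈ U, s (t e))]
    nlinarith [mul_nonneg hM0 (sq_nonneg (|∑ e ∈ U, s (t e)| - c))]
  calc _ ≤ ∫ t, M / (2 * c) * ((∑ e ∈ U, s (t e)) ^ 2 + c ^ 2) ∂envMeasure d G := by
        refine integral_mono_ae ?_ ((hS2.add (integrable_const _)).const_mul _) hbound
        refine integrable_of_bounded_on_Icc hsupp (hSm.mul hF) (M := U.card * M) fun t ht => ?_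
        rw [abs_mul]
        exact mul_le_mul (hSb t) (hM t ht) (abs_nonneg _) (by positivity)
    _ = M / (2 * c) * (∫ t, (∑ e ∈ U, s (t e)) ^ 2 ∂envMeasure d G + c ^ 2) := by
        rw [integral_const_mul, integral_add hS2 (integrable_const _)]
        simp
    _ ≤ M / (2 * c) * (c ^ 2 + c ^ 2) := by
        gcongr
        rw [hcc]
        exact integral_sum_score_sq_le hs hsupp U
    _ = M * c := by field_simp; ring

end environment

/-! ### Translation invariance. -/

section translation

/-- Translations act on the lattice by graph homomorphisms. -/
def shiftHom (x : Fin d → ℤ) : lattice d →g lattice d where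
  toFun y := x + y
  map_rel' h := by
    rw [lattice_adj_iff] at h ⊢
    simpa using h

/-- The action of a translation on edges. -/
def shiftEdge (x : Fin d → ℤ) : Edge d → Edge d := (shiftHom x).mapEdgeSet

lemma val_shiftEdge (x : Fin d → ℤ) (e : Edge d) :
    (shiftEdge x e : Sym2 (Fin d → ℤ)) = Sym2.map (x + ·) e := rfl

lemma shiftEdge_shiftEdge_neg (x : Fin d → ℤ) (e : Edge d) :
    shiftEdge x (shiftEdge (-x) e) = e := by
  apply Subtype.ext
  rw [val_shiftEdge, val_shiftEdge, Sym2.map_map]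
  have : ((x + ·) ∘ (-x + ·) : (Fin d → ℤ) → Fin d → ℤ) = id := by ext y; simp
  rw [this, Sym2.map_id, id]

lemma shiftEdge_neg_shiftEdge (x : Fin d → ℤ) (e : Edge d) :
    shiftEdge (-x) (shiftEdge x e) = e := by
  simpa using shiftEdge_shiftEdge_neg (-x) e

lemma shiftEdge_injective (x : Fin d → ℤ) : Function.Injective (shiftEdge x) :=
  Function.LeftInverse.injective (shiftEdge_neg_shiftEdge x)

/-- Two translates could agree with endpoints exchanged; adding the two resulting equations still
gives `2x = 2x'`. Thus the translates of one edge by a cube are distinct edges. -/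
lemma shiftEdge_left_injective (e : Edge d) : Function.Injective fun x => shiftEdge x e := by
  intro x x' h
  have h' := congrArg Subtype.val h
  simp only [val_shiftEdge] at h'
  obtain ⟨e, he⟩ := e
  obtain ⟨p, q⟩ := e
  change s(x + p, x + q) = s(x' + p, x' + q) at h'
  rw [Sym2.eq_iff] at h'
  rcases h' with ⟨h1, -⟩ | ⟨h1, h2⟩
  · exact add_right_cancel h1
  · funext i
    have h1 := congrFun h1 i
    have h2 := congrFun h2 i
    simp only [Pi.add_apply] at h1 h2
    omega

variable {u v : Fin d → ℤ}

/-- The translate of a walk. -/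
def shiftWalk (x : Fin d → ℤ) (p : (lattice d).Walk u v) : (lattice d).Walk (x + u) (x + v) :=
  p.map (shiftHom x)

lemma edgeList_shiftWalk (x : Fin d → ℤ) (p : (lattice d).Walk u v) :
    edgeList (shiftWalk x p) = (edgeList p).map (shiftEdge x) := by
  apply List.map_injective_iff.2 Subtype.val_injective
  rw [map_val_edgeList]
  refine (SimpleGraph.Walk.edges_map (shiftHom x) p).trans ?_
  rw [← map_val_edgeList, List.map_map, List.map_map]
  rfl

lemma pathTime_shiftWalk (t : Edge d → ℝ) (x : Fin d → ℤ) (p : (lattice d).Walk u v) :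
    pathTime t (shiftWalk x p) = pathTime (fun e => t (shiftEdge x e)) p := by
  rw [pathTime_eq_sum, pathTime_eq_sum, edgeList_shiftWalk, List.map_map]
  rfl

lemma passageTime_shift_le {t : Edge d → ℝ} (ht : ∀ e, 0 ≤ t e) (x u v : Fin d → ℤ) :
    passageTime t (x + u) (x + v) ≤ passageTime (fun e => t (shiftEdge x e)) u v :=
  le_ciInf fun p => by
    rw [← pathTime_shiftWalk]
    exact passageTime_le ht _

lemma passageTime_shift {t : Edge d → ℝ} (ht : ∀ e, 0 ≤ t e) (x u v : Fin d → ℤ) :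
    passageTime (fun e => t (shiftEdge x e)) u v = passageTime t (x + u) (x + v) := by
  refine le_antisymm ?_ (passageTime_shift_le ht x u v)
  have := passageTime_shift_le (t := fun e => t (shiftEdge x e)) (fun e => ht _) (-x) (x + u) (x + v)
  simpa [shiftEdge_shiftEdge_neg] using this

lemma shiftEdge_mem_geodesic {t : Edge d → ℝ} (ht : ∀ e, 0 ≤ t e) {e : Edge d}
    (he : e ∈ geodesic t u v) (x : Fin d → ℤ) :
    shiftEdge x e ∈ geodesic (fun e => t (shiftEdge (-x) e)) (x + u) (x + v) := by
  obtain ⟨p, hp, hep⟩ := mem_geodesic.1 he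
  refine mem_geodesic.2 ⟨shiftWalk x p, ?_, ?_⟩
  · change pathTime _ _ = _
    have := passageTime_shift (t := fun e => t (shiftEdge (-x) e)) (fun e => ht _) x u v
    rw [pathTime_shiftWalk, ← this]
    simp only [shiftEdge_neg_shiftEdge]
    exact hp
  · rw [edgeList_shiftWalk]
    exact List.mem_map_of_mem hep

variable {G : Measure ℝ} [IsProbabilityMeasure G]

lemma measurePreserving_shift (x : Fin d → ℤ) :
    MeasurePreserving (fun (t : Edge d → ℝ) e => t (shiftEdge x e)) (envMeasure d G)
      (envMeasure d G) :=
  ⟨measurable_pi_lambda _ fun _ => measurable_pi_apply _,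
    Measure.map_infinitePi_infinitePi_of_inj (P := fun _ : Edge d => G) (shiftEdge_injective x)⟩

lemma measureReal_mem_geodesic_shift_le {a b : ℝ} (ha : 0 < a) (hsupp : ∀ᵐ x ∂G, x ∈ Set.Icc a b)
    (x v : Fin d → ℤ) (e : Edge d) :
    (envMeasure d G).real {t | e ∈ geodesic t x (x + v)} ≤
      (envMeasure d G).real {t | shiftEdge (-x) e ∈ geodesic t 0 v} := by
  rw [← (measurePreserving_shift x).measureReal_preimage
    (measurableSet_mem_geodesic 0 v _).nullMeasurableSet]
  refine ENNReal.toReal_mono (measure_ne_top _ _) (measure_mono_ae ?_)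
  filter_upwards [ae_mem_Icc hsupp] with t ht he
  have := shiftEdge_mem_geodesic (fun e => ha.le.trans (ht e).1) he (-x)
  change shiftEdge (-x) e ∈ geodesic (fun e => t (shiftEdge x e)) 0 v
  simpa using this

end translation

/-! ### Expected visit counts and the large deviation estimate. -/

section expectations

variable {G : Measure ℝ} [IsProbabilityMeasure G] {a b : ℝ}

lemma ae_exists_geodesic_path (ha : 0 < a) (hsupp : ∀ᵐ x ∂G, x ∈ Set.Icc a b) (hG : G ≪ volume)
    (u v : Fin d → ℤ) :
    ∀ᵐ t ∂envMeasure d G, (∀ e, t e ∈ Set.Icc a b) ∧ ∃ p : (lattice d).Walk u v,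
      IsGeodesic t p ∧ p.IsPath ∧ ∀ e, e ∈ geodesic t u v ↔ e ∈ edgeList p := by
  filter_upwards [ae_mem_Icc hsupp, ae_geodesic_unique hG u v] with t ht huniq
  obtain ⟨p, hp, hpath⟩ := exists_isGeodesic_isPath ha (fun e => (ht e).1) u v
  refine ⟨ht, p, hp, hpath, fun e => ⟨fun he => ?_, fun he => mem_geodesic.2 ⟨p, hp, he⟩⟩⟩
  obtain ⟨q, hq, heq⟩ := mem_geodesic.1 he
  exact huniq q p hq hp e heq

lemma integrable_sum_indicator {ι Ω : Type*} [MeasurableSpace Ω] {μ : Measure Ω} [IsFiniteMeasure μ]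
    (S : Finset ι) {A : ι → Set Ω} (hA : ∀ i, MeasurableSet (A i)) :
    Integrable (fun ω => ∑ i ∈ S, (A i).indicator (1 : Ω → ℝ) ω) μ :=
  integrable_finsetSum _ fun i _ => (integrable_const (1 : ℝ)).indicator (hA i)

lemma integral_sum_indicator {ι Ω : Type*} [MeasurableSpace Ω] {μ : Measure Ω} [IsFiniteMeasure μ]
    (S : Finset ι) {A : ι → Set Ω} (hA : ∀ i, MeasurableSet (A i)) :
    ∫ ω, ∑ i ∈ S, (A i).indicator (1 : Ω → ℝ) ω ∂μ = ∑ i ∈ S, μ.real (A i) := by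
  rw [integral_finsetSum (f := fun i => (A i).indicator (1 : Ω → ℝ)) _
    fun i _ => (integrable_const (1 : ℝ)).indicator (hA i)]
  exact Finset.sum_congr rfl fun i _ => integral_indicator_one (hA i)

lemma sum_indicator_eq_card {ι Ω : Type*} (S : Finset ι) (A : ι → Set Ω) (ω : Ω)
    [DecidablePred fun i => ω ∈ A i] :
    ∑ i ∈ S, (A i).indicator (1 : Ω → ℝ) ω = (S.filter fun i => ω ∈ A i).card := by
  simp [Set.indicator_apply]

/-- The sum is the expected number of edges of `S` on the geodesic, so a deterministic bound valid
for every geodesic path suffices. -/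
lemma sum_measureReal_mem_geodesic_le (ha : 0 < a) (hsupp : ∀ᵐ x ∂G, x ∈ Set.Icc a b)
    (hG : G ≪ volume) (u v : Fin d → ℤ) (S : Finset (Edge d)) {K : ℝ}
    (hK : ∀ t : Edge d → ℝ, (∀ e, t e ∈ Set.Icc a b) → ∀ p : (lattice d).Walk u v,
      IsGeodesic t p → p.IsPath → ((S.filter fun e => e ∈ edgeList p).card : ℝ) ≤ K) :
    ∑ e ∈ S, (envMeasure d G).real {t | e ∈ geodesic t u v} ≤ K := by
  classical
  have hm : ∀ e : Edge d, MeasurableSet {t | e ∈ geodesic t u v} :=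
    measurableSet_mem_geodesic u v
  rw [← integral_sum_indicator S hm]
  calc _ ≤ ∫ _, K ∂envMeasure d G := by
        refine integral_mono_ae (integrable_sum_indicator S hm) (integrable_const _) ?_
        filter_upwards [ae_exists_geodesic_path ha hsupp hG u v] with t ⟨ht, p, hp, hpath, hiff⟩
        rw [sum_indicator_eq_card]
        refine le_trans (le_of_eq ?_) (hK t ht p hp hpath)
        congr 2
        ext e
        simp [hiff]
    _ = K := by simp

/-- The expected number of edges of the geodesic in a ball is at most linear in the radius. -/
lemma sum_measureReal_near_le (ha : 0 < a) (hab : a ≤ b) (hsupp : ∀ᵐ x ∂G, x ∈ Set.Icc a b)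
    (hG : G ≪ volume) (u v z : Fin d → ℤ) (n : ℕ) (S : Finset (Edge d))
    (hS : ∀ e ∈ S, Near e z n) :
    ∑ e ∈ S, (envMeasure d G).real {t | e ∈ geodesic t u v} ≤ b / a * (2 * (n + 1)) + 1 := by
  refine sum_measureReal_mem_geodesic_le ha hsupp hG u v S fun t ht p hp _ => ?_
  refine card_edges_near_le ha (fun e => (ht e).1) (fun e => (ht e).2) hab hp z n fun e he => ?_
  exact ⟨(Finset.mem_filter.1 he).2, hS e (Finset.mem_filter.1 he).1⟩

lemma sum_measureReal_geodesic_le (ha : 0 < a) (hsupp : ∀ᵐ x ∂G, x ∈ Set.Icc a b)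
    (hG : G ≪ volume) (v : Fin d → ℤ) (S : Finset (Edge d)) :
    ∑ e ∈ S, (envMeasure d G).real {t | e ∈ geodesic t 0 v} ≤ b / a * l1 v := by
  refine sum_measureReal_mem_geodesic_le ha hsupp hG 0 v S fun t ht p hp hpath => ?_
  have h1 := length_mul_le_pathTime (fun e => (ht e).1) p
  have h2 := passageTime_le_mul_l1 (fun e => ha.le.trans (ht e).1) (fun e => (ht e).2) 0 v
  rw [← hp, sub_zero] at h2
  have h3 : (p.length : ℝ) ≤ b / a * l1 v := by
    rw [div_mul_eq_mul_div, le_div_iff₀ ha]; linarith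
  refine le_trans ?_ h3
  have h4 : (S.filter fun e => e ∈ edgeList p).card ≤ p.length := by
    rw [← length_edgeList]
    refine le_trans (Finset.card_le_card fun e he => ?_) (List.toFinset_card_le (edgeList p))
    simpa using (Finset.mem_filter.1 he).2
  exact_mod_cast h4

/-- The discrete cube of side `w`. -/
noncomputable def cube (d w : ℕ) : Finset (Fin d → ℤ) := Fintype.piFinset fun _ => Finset.Ico (0 : ℤ) w

lemma card_cube (d w : ℕ) : (cube d w).card = w ^ d := by simp [cube]

lemma l1_le_of_mem_cube {w : ℕ} {x : Fin d → ℤ} (hx : x ∈ cube d w) : l1 x ≤ d * w := by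
  unfold l1
  refine (Finset.sum_le_card_nsmul _ _ w fun i _ => ?_).trans (by simp)
  have := Fintype.mem_piFinset.1 hx i
  rw [Finset.mem_Ico] at this
  omega

/-- Translating back to the origin turns the sum over shifts into a sum over distinct edges near `e`
for the single geodesic `γ(0,v)`, which has linearly many edges in a ball. Divided by the `w ^ d`
shifts, this is `O(w^(1-d))`. -/
lemma sum_cube_measureReal_le (ha : 0 < a) (hab : a ≤ b) (hsupp : ∀ᵐ x ∂G, x ∈ Set.Icc a b)
    (hG : G ≪ volume) (v : Fin d → ℤ) (w : ℕ) (e : Edge d) :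
    ∑ x ∈ cube d w, (envMeasure d G).real {t | e ∈ geodesic t x (x + v)} ≤
      b / a * (2 * ((d * w : ℕ) + 1)) + 1 := by
  have hinj : Function.Injective fun x : Fin d → ℤ => shiftEdge (-x) e := fun x x' h =>
    neg_injective (shiftEdge_left_injective e h)
  calc _ ≤ ∑ x ∈ cube d w, (envMeasure d G).real {t | shiftEdge (-x) e ∈ geodesic t 0 v} :=
        Finset.sum_le_sum fun x _ => measureReal_mem_geodesic_shift_le ha hsupp x v e
    _ = ∑ e' ∈ (cube d w).image fun x => shiftEdge (-x) e,
          (envMeasure d G).real {t | e' ∈ geodesic t 0 v} := by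
        rw [Finset.sum_image fun x _ x' _ h => hinj h]
    _ ≤ _ := by
        refine sum_measureReal_near_le ha hab hsupp hG 0 v e.base (d * w) _ fun e' he' => ?_
        obtain ⟨x, hx, rfl⟩ := Finset.mem_image.1 he'
        refine ⟨-x + e.base, ?_, ?_⟩
        · rw [val_shiftEdge]
          exact Sym2.mem_map.2 ⟨_, e.base_mem, rfl⟩
        · rw [add_sub_cancel_right, l1_neg]
          exact l1_le_of_mem_cube hx

/-- Large deviation estimate for the number of low edges of lattice paths. -/
lemma measureReal_manyLowEdges_le {c θ : ℝ} (hθ0 : 0 ≤ θ) (hθ1 : θ ≤ 1)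
    (hc : G (Set.Iio c) ≤ ENNReal.ofReal (θ ^ 2)) (B R : ℕ) :
    (envMeasure d G).real (manyLowEdges d B R c) ≤ (2 * B + 1) ^ d * (4 * d * θ) ^ R := by
  have hsub : manyLowEdges d B R c ⊆ ⋃ x ∈ ball (0 : Fin d → ℤ) B, ⋃ l ∈ walkLists R x,
      ⋃ S ∈ l.toFinset.powerset.filter fun S => R ≤ 2 * S.card,
        (S : Set (Edge d)).pi fun _ => Set.Iio c := by
    rintro t ⟨x, hx, l, hl, hR⟩
    simp only [Set.mem_iUnion]
    refine ⟨x, hx, l, hl, l.toFinset.filter fun e => t e < c, ?_, ?_⟩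
    · simpa using hR
    · intro e he
      simpa using (Finset.mem_filter.1 he).2
  -- Only half of the `R` edges need be low, so a probability `θ ^ 2` per edge is what yields `θ ^
  -- R`.
  have hS : ∀ S : Finset (Edge d), R ≤ 2 * S.card →
      (envMeasure d G).real ((S : Set (Edge d)).pi fun _ => Set.Iio c) ≤ θ ^ R := by
    intro S hRS
    unfold envMeasure Measure.real
    rw [Measure.infinitePi_pi _ fun _ _ => measurableSet_Iio, Finset.prod_const, ENNReal.toReal_pow]
    calc _ ≤ (θ ^ 2) ^ S.card :=
          pow_le_pow_left₀ ENNReal.toReal_nonneg (ENNReal.toReal_le_of_le_ofReal (by positivity) hc) _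
      _ = θ ^ (2 * S.card) := by rw [pow_mul]
      _ ≤ θ ^ R := pow_le_pow_of_le_one hθ0 hθ1 hRS
  have hl : ∀ x : Fin d → ℤ, ∀ l ∈ walkLists R x,
      (envMeasure d G).real (⋃ S ∈ l.toFinset.powerset.filter fun S => R ≤ 2 * S.card,
        (S : Set (Edge d)).pi fun _ => Set.Iio c) ≤ 2 ^ R * θ ^ R := by
    intro x l hl
    refine (measureReal_biUnion_finset_le _ _).trans ?_
    refine (Finset.sum_le_card_nsmul _ _ (θ ^ R) fun S hS' => hS S (Finset.mem_filter.1 hS').2).trans ?_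
    rw [nsmul_eq_mul]
    gcongr
    have h1 : (l.toFinset.powerset.filter fun S => R ≤ 2 * S.card).card ≤ 2 ^ R := by
      refine (Finset.card_filter_le _ _).trans ?_
      rw [Finset.card_powerset]
      exact Nat.pow_le_pow_right (by norm_num)
        ((List.toFinset_card_le l).trans (length_of_mem_walkLists hl).le)
    exact_mod_cast h1
  have hx : ∀ x : Fin d → ℤ, (envMeasure d G).real (⋃ l ∈ walkLists R x,
      ⋃ S ∈ l.toFinset.powerset.filter fun S => R ≤ 2 * S.card,
        (S : Set (Edge d)).pi fun _ => Set.Iio c) ≤ (2 * d) ^ R * (2 ^ R * θ ^ R) := by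
    intro x
    refine (measureReal_biUnion_finset_le _ _).trans ?_
    refine (Finset.sum_le_card_nsmul _ _ _ fun l hl' => hl x l hl').trans ?_
    rw [nsmul_eq_mul]
    gcongr
    exact_mod_cast card_walkLists_le R x
  refine (measureReal_mono hsub (measure_ne_top _ _)).trans ?_
  refine (measureReal_biUnion_finset_le _ _).trans ?_
  refine (Finset.sum_le_card_nsmul _ _ _ fun x _ => hx x).trans ?_
  -- Per step there are `2d` directions and a factor two for choosing the subset of low edges.
  rw [nsmul_eq_mul, show (4 * d * θ : ℝ) = 2 * d * (2 * θ) by ring, mul_pow (2 * d : ℝ), mul_pow 2 θ]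
  gcongr
  exact_mod_cast card_ball_le (0 : Fin d → ℤ) B

/-- The expected number of visits to a set of edges is controlled by the expected number of high
edges of the geodesic in its thickening. -/
lemma sum_measureReal_le_four_mul {c : ℝ} (ha : 0 < a) (hsupp : ∀ᵐ x ∂G, x ∈ Set.Icc a b)
    (hG : G ≪ volume) (v : Fin d → ℤ) {R B : ℕ} (hR : 0 < R) (hRv : R ≤ l1 v)
    (hB : b / a * l1 v ≤ B) (E : Finset (Edge d)) :
    ∑ e ∈ E, (envMeasure d G).real {t | e ∈ geodesic t 0 v} ≤
      4 * ∑ e ∈ thickening E R, (envMeasure d G).real {t | e ∈ geodesic t 0 v ∧ c ≤ t e} +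
        E.card * (envMeasure d G).real (manyLowEdges d B R c) := by
  classical
  have hm : ∀ e : Edge d, MeasurableSet {t | e ∈ geodesic t 0 v} :=
    measurableSet_mem_geodesic 0 v
  have hm' : ∀ e : Edge d, MeasurableSet {t | e ∈ geodesic t 0 v ∧ c ≤ t e} := fun e =>
    (hm e).inter (measurableSet_le measurable_const (measurable_pi_apply e))
  -- The measurable hull has the same measure as the bad event and a measurable indicator.
  set D := toMeasurable (envMeasure d G) (manyLowEdges d B R c) with hD
  have hDm : MeasurableSet D := measurableSet_toMeasurable _ _
  have hDr : (envMeasure d G).real (manyLowEdges d B R c) = (envMeasure d G).real D := by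
    simp [Measure.real, hD, measure_toMeasurable]
  rw [hDr, ← integral_sum_indicator E hm, ← integral_sum_indicator _ hm',
    ← integral_indicator_one hDm, ← integral_const_mul, ← integral_const_mul, ← integral_add]
  rotate_left
  · exact (integrable_sum_indicator _ hm').const_mul _
  · exact ((integrable_const (1 : ℝ)).indicator hDm).const_mul _
  refine integral_mono_ae (integrable_sum_indicator _ hm)
    (((integrable_sum_indicator _ hm').const_mul _).add
      (((integrable_const (1 : ℝ)).indicator hDm).const_mul _)) ?_
  filter_upwards [ae_exists_geodesic_path ha hsupp hG 0 v] with t ⟨ht, p, hp, hpath, hiff⟩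
  rw [sum_indicator_eq_card, sum_indicator_eq_card]
  by_cases htD : t ∈ D
  · rw [Set.indicator_of_mem htD, Pi.one_apply, mul_one]
    have h1 : ((E.filter fun e => t ∈ {t | e ∈ geodesic t 0 v}).card : ℝ) ≤ E.card := by
      exact_mod_cast Finset.card_filter_le _ _
    have h2 : (0 : ℝ) ≤ ((thickening E R).filter fun e =>
      t ∈ {t : Edge d → ℝ | e ∈ geodesic t 0 v ∧ c ≤ t e}).card := Nat.cast_nonneg _
    linarith
  · rw [Set.indicator_of_notMem htD, mul_zero, add_zero]
    have h1 := card_filter_le_four_mul ha (fun e => (ht e).1) (fun e => (ht e).2) hp hpath hR hRv hB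
      (fun h => htD (subset_toMeasurable _ _ h)) E (c := c)
    simp only [Set.mem_ofPred_eq, hiff]
    exact_mod_cast h1

end expectations

/-! ### The basic inequality for edges of large influence. -/

section count

variable {G : Measure ℝ} [IsProbabilityMeasure G] {a b : ℝ}

/-- The basic inequality for the number of edges of large influence, at scales `R` and `w`. -/
lemma mul_card_le_of_le_influence {α η : ℝ} (ha : 0 < a) (hα : 0 < α) (hη : 0 < η)
    (hηab : 2 * η ≤ b - a) (hsupp : ∀ᵐ x ∂G, x ∈ Set.Icc a b) (hG : G ≪ volume)
    (hdens : ENNReal.ofReal α • (volume : Measure ℝ).restrict (Set.Icc a b) ≤ G)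
    (v : Fin d → ℤ) {R B : ℕ} (hR : 0 < R) (hRv : R ≤ l1 v) (hB : b / a * l1 v ≤ B) {ε : ℝ}
    (hbad : (envMeasure d G).real (manyLowEdges d B R (a + 2 * η)) ≤ ε / 2) {E : Finset (Edge d)}
    (hE : ∀ e ∈ E, ε ≤ (envMeasure d G).real {t | e ∈ geodesic t 0 v}) {w : ℕ} (hw : 0 < w) :
    α * η ^ 2 / 8 * ε * E.card ≤
      (thickening E R).card * ((b - a) * (b / a * (2 * ((d * w : ℕ) + 1)) + 1)) / w ^ d +
        2 * b * d * w * √(thickening E R).card := by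
  have hab : a ≤ b := by linarith
  have hb0 : 0 ≤ b := ha.le.trans hab
  set U := thickening E R with hU
  obtain ⟨s, hs⟩ := exists_score (G := G) hα hdens (show η ≤ b - a by linarith)
  have hs : IsScore G a b α η s := hs
  set P := envMeasure d G with hP
  have hwd : (0 : ℝ) < (w : ℝ) ^ d := by positivity
  -- The bad event costs at most half of `ε * E.card`, which is absorbed on the left and doubles the
  -- factor four.
  have h1 : ε * E.card ≤ 8 * ∑ e ∈ U, P.real {t | e ∈ geodesic t 0 v ∧ a + 2 * η ≤ t e} := by
    have h2 := sum_measureReal_le_four_mul (c := a + 2 * η) ha hsupp hG v hR hRv hB E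
    have h3 := Finset.card_nsmul_le_sum E _ ε hE
    rw [nsmul_eq_mul] at h3
    have h4 : E.card * P.real (manyLowEdges d B R (a + 2 * η)) ≤ E.card * (ε / 2) :=
      mul_le_mul_of_nonneg_left hbad (Nat.cast_nonneg _)
    linarith
  -- The passage time minus its spatial average: of size `O(w)`, while the average has small
  -- influences.
  set F : (Edge d → ℝ) → ℝ := fun t =>
    passageTime t 0 v - (∑ x ∈ cube d w, passageTime t x (x + v)) / w ^ d with hF
  have hFm : Measurable F := (measurable_passageTime 0 v).sub
    ((Finset.measurable_sum _ fun x _ => measurable_passageTime x (x + v)).div_const _)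
  have hFb : ∀ t : Edge d → ℝ, (∀ e, t e ∈ Set.Icc a b) → |F t| ≤ 2 * b * d * w := by
    intro t ht
    have h0 : F t = (∑ x ∈ cube d w, (passageTime t 0 v - passageTime t x (x + v))) / w ^ d := by
      rw [Finset.sum_sub_distrib, Finset.sum_const, card_cube, nsmul_eq_mul, sub_div]
      simp only [hF]
      congr 1
      push_cast
      field_simp
    rw [h0, abs_div, abs_of_pos hwd, div_le_iff₀ hwd]
    refine (Finset.abs_sum_le_sum_abs _ _).trans ((Finset.sum_le_card_nsmul _ _ (2 * b * d * w)
      fun x hx => ?_).trans (le_of_eq ?_))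
    · have h2 := abs_passageTime_sub_le (b := b) (fun e => ha.le.trans (ht e).1)
        (fun e => (ht e).2) 0 x v (x + v)
      rw [zero_sub, l1_neg, show v - (x + v) = -x by abel, l1_neg] at h2
      have h3 : (l1 x : ℝ) ≤ d * w := by exact_mod_cast l1_le_of_mem_cube hx
      nlinarith [mul_le_mul_of_nonneg_left h3 hb0]
    · rw [card_cube, nsmul_eq_mul]; push_cast; ring
  have h5 := sum_integral_score_mul_le hs hsupp hFm (by positivity) hFb U
  have h6 : ∀ e, ∫ t, s (t e) * F t ∂P = ∫ t, s (t e) * passageTime t 0 v ∂P -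
      (∑ x ∈ cube d w, ∫ t, s (t e) * passageTime t x (x + v) ∂P) / w ^ d := by
    intro e
    have hint : ∀ x y : Fin d → ℤ, Integrable (fun t => s (t e) * passageTime t x y) P :=
      fun x y => integrable_score_mul hs hsupp (measurable_passageTime x y)
        (fun t ht => abs_passageTime_le ha ht x y) e
    rw [← integral_finsetSum _ fun x _ => hint x (x + v), ← integral_div, ← integral_sub (hint _ _)
      ((integrable_finsetSum _ fun x _ => hint x (x + v)).div_const _)]
    refine integral_congr_ae (.of_forall fun t => ?_)
    simp only [hF]
    rw [← Finset.mul_sum]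
    ring
  have h7 : ∀ e, α * η ^ 2 * P.real {t | e ∈ geodesic t 0 v ∧ a + 2 * η ≤ t e} -
      (b - a) * (b / a * (2 * ((d * w : ℕ) + 1)) + 1) / w ^ d ≤ ∫ t, s (t e) * F t ∂P := by
    intro e
    rw [h6]
    refine sub_le_sub (le_integral_score_mul_passageTime ha hα.le hη hηab hs hsupp 0 v e) ?_
    refine div_le_div_of_nonneg_right ?_ hwd.le
    calc _ ≤ ∑ x ∈ cube d w, (b - a) * P.real {t | e ∈ geodesic t x (x + v)} :=
          Finset.sum_le_sum fun x _ =>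
            integral_score_mul_passageTime_le ha hα hη hηab hdens hs hsupp x (x + v) e
      _ ≤ _ := by
          rw [← Finset.mul_sum]
          exact mul_le_mul_of_nonneg_left (sum_cube_measureReal_le ha hab hsupp hG v w e)
            (by linarith)
  have h8 := (Finset.sum_le_sum fun e (_ : e ∈ U) => h7 e).trans h5
  rw [Finset.sum_sub_distrib, ← Finset.mul_sum, Finset.sum_const, nsmul_eq_mul] at h8
  have h9 := mul_le_mul_of_nonneg_left h1 (show 0 ≤ α * η ^ 2 / 8 by positivity)
  rw [mul_div_assoc'] at h8
  linarith

end count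

/-! ### From the basic inequality to the counting bound. -/

/-- Optimization over the scale `w`. -/
lemma le_of_forall_scale (hd : 2 ≤ d) {A c₁ c₂ : ℝ} (hA : 0 < A) (hc₂ : 0 < c₂) :
    ∃ C : ℝ, 0 < C ∧ ∀ (N : ℕ) (D ε : ℝ), 1 ≤ D → 0 < ε → ε ≤ 1 →
      (∀ w : ℕ, 0 < w → A * ε * N ≤ N * D * c₁ * w / w ^ d + c₂ * w * √(N * D)) →
      (N : ℝ) ≤ C * D ^ ((d + 1) / (d - 1) : ℝ) * ε ^ (-(2 * d / (d - 1)) : ℝ) := by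
  -- The maximum with `A` ensures `y ≥ 1` below, so that rounding `x` up at most doubles it.
  set c := max c₁ A with hc
  have hc0 : 0 < c := lt_max_of_lt_right hA
  have hd1 : (0 : ℝ) < d - 1 := by
    have : (2 : ℝ) ≤ d := by exact_mod_cast hd
    linarith
  refine ⟨(4 * c₂ / A) ^ 2 * (2 * c / A) ^ (2 / (d - 1) : ℝ), by positivity, ?_⟩
  intro N D ε hD hε hε1 h
  have hD0 : 0 < D := by linarith
  -- Once `w ^ (d - 1) ≥ y`, the first term on the right is at most half of the left side; `w` is
  -- essentially the smallest such scale.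
  set y := 2 * c * D / (A * ε) with hy
  have hy1 : 1 ≤ y := by
    rw [hy, one_le_div (by positivity)]
    have h1 : A * ε ≤ A * 1 := by gcongr
    have h2 : A ≤ c := le_max_right _ _
    have h3 : c * 1 ≤ c * D := by gcongr
    nlinarith
  have hy0 : 0 < y := by linarith
  set x := y ^ (1 / (d - 1) : ℝ) with hx
  have hx1 : 1 ≤ x := Real.one_le_rpow hy1 (by positivity)
  have hxpow : x ^ (d - 1) = y := by
    rw [hx, ← Real.rpow_natCast, ← Real.rpow_mul hy0.le, Nat.cast_sub (by omega), Nat.cast_one,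
      one_div_mul_cancel hd1.ne', Real.rpow_one]
  have hxsq : x ^ 2 = y ^ (2 / (d - 1) : ℝ) := by
    rw [hx, ← Real.rpow_natCast, ← Real.rpow_mul hy0.le]
    congr 1
    push_cast
    ring
  set w := ⌈x⌉₊ with hw
  have hwx : x ≤ w := Nat.le_ceil x
  have hw2 : (w : ℝ) ≤ 2 * x := by
    have := Nat.ceil_lt_add_one (zero_le_one.trans hx1)
    linarith
  have hw0 : 0 < w := Nat.ceil_pos.2 (by linarith)
  have hw0' : (0 : ℝ) < w := by exact_mod_cast hw0
  have h1 := h w hw0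
  have hwd : (w : ℝ) ^ d = w * w ^ (d - 1) := by
    rw [← pow_succ']; congr 1; omega
  have h2 : N * D * c₁ * w / w ^ d ≤ A * ε * N / 2 := by
    have h3 : y ≤ (w : ℝ) ^ (d - 1) := hxpow ▸ pow_le_pow_left₀ (by linarith) hwx _
    have h4 : N * D * c₁ * w / w ^ d = N * D * c₁ / w ^ (d - 1) := by
      rw [hwd]; field_simp
    rw [h4]
    calc N * D * c₁ / w ^ (d - 1) ≤ N * D * c / y := by
          gcongr
          exact le_max_left _ _
      _ = A * ε * N / 2 := by rw [hy]; field_simp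
  rcases Nat.eq_zero_or_pos N with hN | hN
  · rw [hN, Nat.cast_zero]; positivity
  have hN' : (0 : ℝ) < N := by exact_mod_cast hN
  have h3 : A * ε / 2 * N ≤ c₂ * (2 * x) * √(N * D) := by
    have : c₂ * w * √(N * D) ≤ c₂ * (2 * x) * √(N * D) := by gcongr
    linarith
  -- Squaring leaves `N ^ 2` on the left against `N` on the right, and one factor cancels.
  have h4 : (A * ε / 2 * N) ^ 2 ≤ (c₂ * (2 * x)) ^ 2 * (N * D) := by
    calc _ ≤ (c₂ * (2 * x) * √(N * D)) ^ 2 := pow_le_pow_left₀ (by positivity) h3 2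
      _ = _ := by rw [mul_pow, Real.sq_sqrt (by positivity)]
  have h5 : (N : ℝ) ≤ (4 * c₂ / A) ^ 2 * (x ^ 2 * D / ε ^ 2) := by
    have h6 : (A * ε / 2) ^ 2 * N ≤ (c₂ * (2 * x)) ^ 2 * D := by
      have : N * ((A * ε / 2) ^ 2 * N) ≤ N * ((c₂ * (2 * x)) ^ 2 * D) := by linarith
      exact le_of_mul_le_mul_left this hN'
    have h7 : (4 * c₂ / A) ^ 2 * (x ^ 2 * D / ε ^ 2) = (c₂ * (2 * x)) ^ 2 * D / (A * ε / 2) ^ 2 := by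
      field_simp
      ring
    rw [h7, le_div_iff₀ (by positivity)]
    linarith
  refine h5.trans (le_of_eq ?_)
  rw [hxsq, hy, show 2 * c * D / (A * ε) = (2 * c / A) * D * ε⁻¹ by field_simp,
    Real.mul_rpow (by positivity) (by positivity), Real.mul_rpow (by positivity) (by positivity),
    show ((d + 1) / (d - 1) : ℝ) = 2 / (d - 1) + 1 by field_simp; ring,
    show (-(2 * d / (d - 1)) : ℝ) = -(2 / (d - 1)) - 2 by field_simp; ring,
    Real.rpow_add hD0, Real.rpow_sub hε, Real.rpow_one, Real.rpow_neg hε.le,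
    Real.inv_rpow hε.le, Real.rpow_two]
  ring

section norms

lemma norm2_le_l1 (v : Fin d → ℤ) : norm2 v ≤ l1 v := by
  unfold norm2 l1
  rw [Real.sqrt_le_left (by positivity)]
  push_cast
  have : ∀ i, (v i : ℝ) ^ 2 = (|(v i : ℝ)|) ^ 2 := fun i => (sq_abs _).symm
  simp only [this, Nat.cast_natAbs, Int.cast_abs]
  exact Finset.sum_sq_le_sq_sum_of_nonneg fun i _ => abs_nonneg _

lemma l1_le_mul_norm2 (v : Fin d → ℤ) : (l1 v : ℝ) ≤ d * norm2 v := by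
  unfold l1
  push_cast
  have h : ∀ i, (|v i| : ℝ) ≤ norm2 v := by
    intro i
    unfold norm2
    rw [← Real.sqrt_sq_eq_abs]
    exact Real.sqrt_le_sqrt (Finset.single_le_sum (f := fun i => (v i : ℝ) ^ 2)
      (fun _ _ => sq_nonneg _) (Finset.mem_univ i))
  refine (Finset.sum_le_card_nsmul _ _ (norm2 v) fun i _ => ?_).trans (by simp)
  simpa using h i

end norms

section count

variable {G : Measure ℝ} [IsProbabilityMeasure G] {a b : ℝ}

/-- `G` gives no mass to `(-∞, a]`, so continuity from above makes the mass of `(-∞, a + 2η)` small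
as `η` decreases to zero. -/
lemma exists_small_left_mass (hab : a < b) (hsupp : ∀ᵐ x ∂G, x ∈ Set.Icc a b) (hG : G ≪ volume)
    {δ : ℝ} (hδ : 0 < δ) :
    ∃ η : ℝ, 0 < η ∧ 2 * η ≤ b - a ∧ G (Set.Iio (a + 2 * η)) ≤ ENNReal.ofReal δ := by
  set f : ℕ → ℝ := fun n => (b - a) / (2 * (n + 1)) with hf
  have hba : 0 < b - a := by linarith
  have hanti : Antitone fun n : ℕ => Set.Iio (a + 2 * f n) := by
    intro m n hmn
    refine Set.Iio_subset_Iio ?_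
    have : f n ≤ f m := by
      simp only [hf]
      gcongr
    linarith
  have hlim : Filter.Tendsto f Filter.atTop (nhds 0) := by
    have := (tendsto_one_div_add_atTop_nhds_zero_nat (𝕜 := ℝ)).const_mul ((b - a) / 2)
    rw [mul_zero] at this
    refine this.congr fun n => ?_
    simp only [hf]
    field_simp
  have hzero : G (⋂ n, Set.Iio (a + 2 * f n)) = 0 := by
    have h1 : (⋂ n, Set.Iio (a + 2 * f n)) ⊆ Set.Iic a := by
      intro x hx
      have h2 : Filter.Tendsto (fun n => a + 2 * f n) Filter.atTop (nhds a) := by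
        simpa using (hlim.const_mul 2).const_add a
      exact ge_of_tendsto' h2 fun n => (Set.mem_iInter.1 hx n).le
    have h3 : Set.Iic a ⊆ (Set.Icc a b)ᶜ ∪ {a} := by
      intro x hx
      rcases eq_or_lt_of_le (Set.mem_Iic.1 hx) with h | h
      · exact Or.inr h
      · exact Or.inl fun h' => absurd h'.1 (not_le.2 h)
    refine measure_mono_null (h1.trans h3) (measure_union_null ?_ (hG Real.volume_singleton))
    exact hsupp
  have ht := tendsto_measure_iInter_atTop (μ := G)
    (fun n => (measurableSet_Iio (a := a + 2 * f n)).nullMeasurableSet) hanti ⟨0, measure_ne_top _ _⟩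
  rw [hzero] at ht
  obtain ⟨n, hn⟩ := (ht.eventually (gt_mem_nhds (ENNReal.ofReal_pos.2 hδ))).exists
  refine ⟨f n, by positivity, ?_, hn.le⟩
  simp only [hf]
  rw [mul_div_assoc', div_le_iff₀ (by positivity)]
  nlinarith [(Nat.cast_nonneg n : (0 : ℝ) ≤ n)]

/-- The number of edges of influence at least `ε`, far from the origin. -/
lemma exists_count_bound_far (hd : 2 ≤ d) {α : ℝ} (ha : 0 < a) (hab : a < b) (hα : 0 < α)
    (hsupp : ∀ᵐ x ∂G, x ∈ Set.Icc a b) (hG : G ≪ volume)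
    (hdens : ENNReal.ofReal α • (volume : Measure ℝ).restrict (Set.Icc a b) ≤ G) :
    ∃ C V₀ : ℝ, 0 < C ∧ ∀ v : Fin d → ℤ, 2 ≤ norm2 v → V₀ ≤ norm2 v →
      ∀ ε : ℝ, norm2 v ^ (-(d + 2 : ℝ)) ≤ ε → ε ≤ 1 → ∀ E : Finset (Edge d),
        (∀ e ∈ E, ε ≤ (envMeasure d G).real {t | e ∈ geodesic t 0 v}) →
        (E.card : ℝ) ≤ C * ε ^ (-(2 * d / (d - 1)) : ℝ) *
          Real.log (norm2 v) ^ (d * (d + 1) / (d - 1) : ℝ) := by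
  have hd0 : (0 : ℝ) < d := by
    have : 0 < d := by omega
    exact_mod_cast this
  have hd1 : (0 : ℝ) < d - 1 := by
    have : (2 : ℝ) ≤ d := by exact_mod_cast hd
    linarith
  have hb : 0 < b := ha.trans hab
  -- Chosen so that the factor `(4dθ)^R` of the large deviation estimate is `e^(-R)`.
  set θ : ℝ := Real.exp (-1) / (4 * d) with hθ
  have hθ0 : 0 < θ := by positivity
  have hd2 : (2 : ℝ) ≤ d := by exact_mod_cast hd
  have hexp1 : Real.exp (-1) ≤ 1 := Real.exp_le_one_iff.2 (by norm_num)
  have hθ1 : θ ≤ 1 := by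
    rw [hθ, div_le_one (by positivity)]
    linarith
  have h4dθ : 4 * d * θ = Real.exp (-1) := by rw [hθ]; field_simp
  obtain ⟨η, hη, hηab, hηG⟩ := exists_small_left_mass hab hsupp hG (show 0 < θ ^ 2 by positivity)
  set c₃ : ℝ := 2 * (b / a * d + 1) + 1 with hc₃
  have hc₃0 : 1 ≤ c₃ := by
    have : 0 ≤ b / a * d := by positivity
    linarith
  -- With `R ≥ K log V`: the summand `d` pays for the starting points, `d + 2` for the smallest
  -- admissible `ε`, and the last term for the constants, using `log V ≥ log 2`.
  set K : ℝ := d + (d + 2) + Real.log (2 * c₃ ^ d) / Real.log 2 with hK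
  have hlog2 : 0 < Real.log 2 := Real.log_pos (by norm_num)
  have hlogc : 0 ≤ Real.log (2 * c₃ ^ d) :=
    Real.log_nonneg (by nlinarith [one_le_pow₀ hc₃0 (n := d)])
  have hK0 : 0 < K := by positivity
  -- The extra term absorbs the rounding in `R`. Beyond `V₀`, `K' log V ≤ V`, so a window of length
  -- `R` fits in the geodesic.
  set K' : ℝ := K + 1 / Real.log 2 with hK'
  have hK'0 : 0 < K' := by positivity
  obtain ⟨C, hC, hCall⟩ := le_of_forall_scale hd (A := α * η ^ 2 / 8)
    (c₁ := (b - a) * (b / a * (2 * (d + 1)) + 1)) (c₂ := 2 * b * d)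
    (by positivity) (by positivity)
  have hlo : ∀ᶠ x : ℝ in Filter.atTop, K' * Real.log x ≤ x := by
    have := (Real.isLittleO_log_id_atTop.const_mul_left K').bound (show (0 : ℝ) < 1 by norm_num)
    filter_upwards [this, Filter.eventually_ge_atTop 1] with x hx hx1
    simp only [Real.norm_eq_abs, id, one_mul] at hx
    rw [abs_of_nonneg (by linarith : (0 : ℝ) ≤ x)] at hx
    exact (le_abs_self _).trans hx
  obtain ⟨V₀, hV₀⟩ := Filter.eventually_atTop.1 hlo
  set c₄ : ℝ := (3 * K') ^ d * (2 * d) with hc₄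
  have hc₄0 : 0 < c₄ := by positivity
  refine ⟨C * c₄ ^ ((d + 1) / (d - 1) : ℝ), V₀, by positivity, ?_⟩
  intro v hv2 hv0 ε hεlow hε1 E hE
  set V := norm2 v with hV
  set L := Real.log V with hL
  have hV0 : 0 < V := by linarith
  have hLlog2 : Real.log 2 ≤ L := Real.log_le_log (by norm_num) hv2
  have hL0 : 0 < L := hlog2.trans_le hLlog2
  have hε0 : 0 < ε := lt_of_lt_of_le (Real.rpow_pos_of_pos hV0 _) hεlow
  set R := ⌈K * L⌉₊ with hR
  have hRpos : 0 < R := Nat.ceil_pos.2 (by positivity)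
  have hRlow : K * L ≤ R := Nat.le_ceil _
  have hRup : (R : ℝ) ≤ K' * L := by
    have h1 := Nat.ceil_lt_add_one (show 0 ≤ K * L by positivity)
    have h2 : 1 ≤ 1 / Real.log 2 * L := by
      rw [one_div, ← div_eq_inv_mul, one_le_div hlog2]; exact hLlog2
    have h3 : K' * L = K * L + 1 / Real.log 2 * L := by rw [hK']; ring
    linarith
  have hRv : R ≤ l1 v := by
    have : (R : ℝ) ≤ l1 v := (hRup.trans (hV₀ V hv0)).trans (norm2_le_l1 v)
    exact_mod_cast this
  set B := ⌈b / a * l1 v⌉₊ with hB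
  have hBup : (2 * B + 1 : ℝ) ≤ c₃ * V := by
    have h1 := Nat.ceil_lt_add_one (show 0 ≤ b / a * l1 v by positivity)
    have h2 : b / a * l1 v ≤ b / a * (d * V) := by
      gcongr
      exact l1_le_mul_norm2 v
    have h3 : c₃ * V = 2 * (b / a * (d * V)) + 3 * V := by rw [hc₃]; ring
    linarith
  have hbad : (envMeasure d G).real (manyLowEdges d B R (a + 2 * η)) ≤ ε / 2 := by
    refine (measureReal_manyLowEdges_le hθ0.le hθ1 hηG B R).trans ?_
    rw [h4dθ]
    have h1 : Real.exp (-1) ^ R ≤ V ^ (-(d + (d + 2)) : ℝ) / (2 * c₃ ^ d) := by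
      have hlog : K * L ≥ (d + (d + 2)) * L + Real.log (2 * c₃ ^ d) := by
        have : Real.log (2 * c₃ ^ d) * 1 ≤ Real.log (2 * c₃ ^ d) * (L / Real.log 2) := by
          gcongr
          rwa [one_le_div hlog2]
        have h2 : K * L = (d + (d + 2)) * L + Real.log (2 * c₃ ^ d) * (L / Real.log 2) := by
          rw [hK]; ring
        linarith
      rw [← Real.exp_nat_mul, Real.rpow_def_of_pos hV0, div_eq_mul_inv,
        ← Real.exp_log (show 0 < (2 * c₃ ^ d)⁻¹ by positivity), Real.log_inv, ← Real.exp_add]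
      refine Real.exp_le_exp.2 ?_
      rw [← hL]
      linarith
    calc (2 * B + 1 : ℝ) ^ d * Real.exp (-1) ^ R
        ≤ (c₃ * V) ^ d * (V ^ (-(d + (d + 2)) : ℝ) / (2 * c₃ ^ d)) := by gcongr
      _ = V ^ (-(d + 2) : ℝ) / 2 := by
          rw [mul_pow, neg_add, Real.rpow_add hV0, Real.rpow_neg hV0.le (d : ℝ), Real.rpow_natCast]
          field_simp
      _ ≤ ε / 2 := by gcongr
  set D : ℝ := (((2 * R + 1) ^ d * (2 * d) : ℕ) : ℝ) with hD
  have hR1 : (1 : ℝ) ≤ R := by exact_mod_cast hRpos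
  have hD1 : 1 ≤ D := by
    have : 1 ≤ (2 * R + 1) ^ d * (2 * d) := Nat.one_le_iff_ne_zero.2 (by positivity)
    rw [hD]
    exact_mod_cast this
  have hDup : D ≤ c₄ * L ^ (d : ℝ) := by
    rw [hD, hc₄, Real.rpow_natCast]
    push_cast
    calc (2 * R + 1 : ℝ) ^ d * (2 * d) ≤ (3 * (K' * L)) ^ d * (2 * d) := by
          gcongr
          linarith
      _ = _ := by rw [← mul_assoc 3, mul_pow (3 * K')]; ring
  have hcard : ((thickening E R).card : ℝ) ≤ E.card * D := by
    rw [hD]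
    exact_mod_cast card_thickening_le E R
  have hba : 0 < b - a := by linarith
  have key := hCall E.card D ε hD1 hε0 hε1 fun w hw => by
    have hw1 : (1 : ℝ) ≤ w := by exact_mod_cast hw
    refine (mul_card_le_of_le_influence ha hα hη hηab hsupp hG hdens v hRpos hRv (Nat.le_ceil _)
      hbad hE hw).trans ?_
    refine add_le_add ?_ ?_
    · refine div_le_div_of_nonneg_right ?_ (by positivity)
      rw [mul_assoc (E.card * D)]
      refine mul_le_mul hcard ?_ (by positivity) (by positivity)
      rw [mul_assoc]
      refine mul_le_mul_of_nonneg_left ?_ hba.le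
      push_cast
      rw [add_mul, one_mul, mul_assoc]
      refine add_le_add ?_ hw1
      refine mul_le_mul_of_nonneg_left ?_ (by positivity)
      nlinarith
    · gcongr
  refine key.trans ?_
  have hp : (0 : ℝ) ≤ (d + 1) / (d - 1) := by positivity
  calc C * D ^ ((d + 1) / (d - 1) : ℝ) * ε ^ (-(2 * d / (d - 1)) : ℝ)
      ≤ C * (c₄ * L ^ (d : ℝ)) ^ ((d + 1) / (d - 1) : ℝ) * ε ^ (-(2 * d / (d - 1)) : ℝ) := by
        gcongr
    _ = _ := by
        rw [Real.mul_rpow hc₄0.le (by positivity), ← Real.rpow_mul hL0.le, mul_div_assoc' (d : ℝ)]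
        ring

end count

/-! ### Dyadic summation of powers of the influences. -/

section sums

variable {ι : Type*}

/-- Dyadic summation of powers from a bound on the counting function. -/
lemma sum_rpow_le_of_card_le {S : Finset ι} {p : ι → ℝ} (hp0 : ∀ i, 0 ≤ p i) (hp1 : ∀ i, p i ≤ 1)
    {M W β γ : ℝ} (hβ : 1 ≤ β) (hW : ∑ i ∈ S, p i ≤ W) (m : ℕ)
    (hcount : ∀ j < m, ∀ E ⊆ S, (∀ i ∈ E, (1 / 2 : ℝ) ^ (j + 1) ≤ p i) →
      (E.card : ℝ) ≤ M * ((1 / 2 : ℝ) ^ (j + 1)) ^ (-γ)) :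
    ∑ i ∈ S, p i ^ β ≤ W * ((1 / 2 : ℝ) ^ m) ^ (β - 1) +
      M * 2 ^ γ * ∑ j ∈ Finset.range m, ((2 : ℝ) ^ (γ - β)) ^ j := by
  classical
  -- For small values, one factor `p i` is kept for the bound `W` on the sum and the others are
  -- bounded by the threshold.
  have hlow : ∑ i ∈ S with p i ≤ (1 / 2 : ℝ) ^ m, p i ^ β ≤ W * ((1 / 2 : ℝ) ^ m) ^ (β - 1) := by
    calc _ ≤ ∑ i ∈ S with p i ≤ (1 / 2 : ℝ) ^ m, p i * ((1 / 2 : ℝ) ^ m) ^ (β - 1) := by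
          refine Finset.sum_le_sum fun i hi => ?_
          have hi' := (Finset.mem_filter.1 hi).2
          rcases eq_or_lt_of_le (hp0 i) with h | h
          · rw [← h, Real.zero_rpow (by linarith), zero_mul]
          · calc p i ^ β = p i * p i ^ (β - 1) := by
                  rw [Real.rpow_sub_one h.ne']; field_simp
              _ ≤ _ := mul_le_mul_of_nonneg_left
                  (Real.rpow_le_rpow h.le hi' (by linarith)) h.le
      _ ≤ _ := by
          rw [← Finset.sum_mul]
          refine mul_le_mul_of_nonneg_right (le_trans ?_ hW) (by positivity)
          exact Finset.sum_le_sum_of_subset_of_nonneg (Finset.filter_subset _ _) fun i _ _ => hp0 i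
  have hhigh : ∀ k ≤ m, ∑ i ∈ S with ¬ p i ≤ (1 / 2 : ℝ) ^ k, p i ^ β ≤
      M * 2 ^ γ * ∑ j ∈ Finset.range k, ((2 : ℝ) ^ (γ - β)) ^ j := by
    intro k
    induction k with
    | zero =>
      intro _
      rw [Finset.filter_false_of_mem]
      · simp
      · intro i _
        simpa using hp1 i
    | succ k ih =>
      intro hk
      set E := S.filter fun i => ¬ p i ≤ (1 / 2 : ℝ) ^ (k + 1) ∧ p i ≤ (1 / 2 : ℝ) ^ k with hE
      have hpow : (1 / 2 : ℝ) ^ (k + 1) ≤ (1 / 2 : ℝ) ^ k :=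
        pow_le_pow_of_le_one (by norm_num) (by norm_num) (Nat.le_succ k)
      have hsplit : ∑ i ∈ S with ¬ p i ≤ (1 / 2 : ℝ) ^ (k + 1), p i ^ β =
          ∑ i ∈ S with ¬ p i ≤ (1 / 2 : ℝ) ^ k, p i ^ β + ∑ i ∈ E, p i ^ β := by
        rw [← Finset.sum_filter_add_sum_filter_not
          (S.filter fun i => ¬ p i ≤ (1 / 2 : ℝ) ^ (k + 1)) (fun i => ¬ p i ≤ (1 / 2 : ℝ) ^ k),
          Finset.filter_filter, Finset.filter_filter]
        congr 1
        · refine Finset.sum_congr (Finset.filter_congr fun i _ => ?_) fun _ _ => rfl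
          exact ⟨fun h => h.2, fun h => ⟨fun h' => h (h'.trans hpow), h⟩⟩
        · simp only [hE, not_not]
      -- On a dyadic layer the count uses the lower end and the size of `p i` the upper end; this
      -- mismatch produces the factor `2 ^ γ`.
      have hEsum : ∑ i ∈ E, p i ^ β ≤ M * 2 ^ γ * ((2 : ℝ) ^ (γ - β)) ^ k := by
        have h1 := hcount k (by omega) E (Finset.filter_subset _ _) fun i hi =>
          (not_le.1 (Finset.mem_filter.1 hi).2.1).le
        calc _ ≤ E.card • ((1 / 2 : ℝ) ^ k) ^ β := Finset.sum_le_card_nsmul _ _ _ fun i hi =>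
              Real.rpow_le_rpow (hp0 i) (Finset.mem_filter.1 hi).2.2 (by linarith)
          _ ≤ M * ((1 / 2 : ℝ) ^ (k + 1)) ^ (-γ) * ((1 / 2 : ℝ) ^ k) ^ β := by
              rw [nsmul_eq_mul]
              exact mul_le_mul_of_nonneg_right h1 (by positivity)
          _ = _ := by
              have h2 : ∀ (n : ℕ) (x : ℝ), ((1 / 2 : ℝ) ^ n) ^ x = 2 ^ (-(n * x)) := by
                intro n x
                rw [one_div, inv_pow, Real.inv_rpow (by positivity), ← Real.rpow_natCast,
                  ← Real.rpow_mul (by norm_num), Real.rpow_neg (by norm_num)]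
              rw [h2, h2, ← Real.rpow_natCast ((2 : ℝ) ^ (γ - β)), ← Real.rpow_mul (by norm_num),
                mul_assoc, mul_assoc, ← Real.rpow_add (by norm_num), ← Real.rpow_add (by norm_num)]
              congr 2
              push_cast
              ring
      rw [hsplit, Finset.sum_range_succ, mul_add]
      exact add_le_add (ih (by omega)) hEsum
  rw [← Finset.sum_filter_add_sum_filter_not S fun i => p i ≤ (1 / 2 : ℝ) ^ m]
  exact add_le_add hlow (hhigh m le_rfl)

/-- The hypotheses under which powers of the influences are summed. -/
structure CountBound (d : ℕ) (C₁ C₂ V : ℝ) (S : Finset ι) (p : ι → ℝ) : Prop where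
  nonneg : ∀ i, 0 ≤ p i
  le_one : ∀ i, p i ≤ 1
  sum_le : ∑ i ∈ S, p i ≤ C₁ * V
  card_le : ∀ ε : ℝ, V ^ (-(d + 2 : ℝ)) ≤ ε → ε ≤ 1 → ∀ E ⊆ S, (∀ i ∈ E, ε ≤ p i) →
    (E.card : ℝ) ≤ C₂ * ε ^ (-(2 * d / (d - 1)) : ℝ) * Real.log V ^ (d * (d + 1) / (d - 1) : ℝ)

variable {C₁ C₂ V : ℝ} {S : Finset ι} {p : ι → ℝ}

lemma CountBound.sum_rpow_le (h : CountBound d C₁ C₂ V S p) {β τ : ℝ} (hβ : 1 ≤ β)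
    (hC₁ : 0 < C₁) (hV : 2 ≤ V) (hτ0 : 0 < τ) (hτ : V ^ (-(d + 2 : ℝ)) ≤ τ) :
    ∃ m : ℕ, (m ≠ 0 → τ ≤ (1 / 2 : ℝ) ^ m) ∧
      ∑ i ∈ S, p i ^ β ≤ C₁ * V * (2 * τ) ^ (β - 1) +
        C₂ * Real.log V ^ (d * (d + 1) / (d - 1) : ℝ) * 2 ^ (2 * d / (d - 1) : ℝ) *
          ∑ j ∈ Finset.range m, ((2 : ℝ) ^ (2 * d / (d - 1) - β : ℝ)) ^ j := by
  have hV1 : V ^ (-(d + 2 : ℝ)) ≤ 1 :=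
    Real.rpow_le_one_of_one_le_of_nonpos (by linarith) (by have : (0 : ℝ) ≤ d := Nat.cast_nonneg d
                                                           linarith)
  -- `m` is the dyadic scale of `min τ 1`: the threshold `2^(-m)` is less than twice `τ`, and every
  -- layer above it is in the range of the counting bound. If `τ ≥ 1` then `m = 0` and there are no
  -- layers.
  obtain ⟨m, hm1, hm2⟩ := exists_nat_pow_near_of_lt_one (x := min τ 1) (y := (1 / 2 : ℝ))
    (lt_min hτ0 one_pos) (min_le_right _ _) (by norm_num) (by norm_num)
  refine ⟨m, fun hm => ?_, ?_⟩
  · rcases le_total τ 1 with h1 | h1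
    · rwa [min_eq_left h1] at hm2
    · rw [min_eq_right h1] at hm2
      exact absurd (pow_lt_one₀ (by norm_num) (by norm_num : (1 / 2 : ℝ) < 1) hm) (not_lt.2 hm2)
  · refine (sum_rpow_le_of_card_le (M := C₂ * Real.log V ^ (d * (d + 1) / (d - 1) : ℝ))
      (γ := (2 * d / (d - 1) : ℝ)) h.nonneg h.le_one hβ h.sum_le m ?_).trans ?_
    · intro j hj E hE hEp
      have h1 : (1 / 2 : ℝ) ^ m ≤ (1 / 2 : ℝ) ^ (j + 1) :=
        pow_le_pow_of_le_one (by norm_num) (by norm_num) (by omega)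
      have h2 := h.card_le ((1 / 2 : ℝ) ^ (j + 1)) (((le_min hτ hV1).trans hm2).trans h1)
        (pow_le_one₀ (by norm_num) (by norm_num)) E hE hEp
      refine h2.trans (le_of_eq ?_)
      ring
    · gcongr
      have : (1 / 2 : ℝ) ^ m = 2 * (1 / 2) ^ (m + 1) := by rw [pow_succ]; ring
      rw [this]
      have := min_le_left τ 1
      linarith

lemma inv_le_log {V : ℝ} (hV : 2 ≤ V) : V⁻¹ ≤ Real.log V := by
  have h1 : Real.log 2 ≤ Real.log V := Real.log_le_log (by norm_num) hV
  have h2 : V⁻¹ ≤ 2⁻¹ := inv_anti₀ (by norm_num) hV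
  have := Real.log_two_gt_d9
  linarith

lemma exists_sum_rpow_le_of_lt (hd : 2 ≤ d) {C₁ C₂ : ℝ} (hC₁ : 0 < C₁) (hC₂ : 0 < C₂) {β : ℝ}
    (hβ : 1 ≤ β) (hβγ : β < 2 * d / (d - 1)) :
    ∃ C : ℝ, 0 < C ∧ ∀ (V : ℝ) (S : Finset ι) (p : ι → ℝ), 2 ≤ V → CountBound d C₁ C₂ V S p →
      ∑ i ∈ S, p i ^ β ≤ C * (V ^ (((d - 1) / (d + 1)) * (2 * d / (d - 1) - β) : ℝ) *
        Real.log V ^ ((β - 1) * d : ℝ)) := by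
  have hd2 : (2 : ℝ) ≤ d := by exact_mod_cast hd
  have hd1 : (0 : ℝ) < d - 1 := by linarith
  set r : ℝ := 2 ^ (2 * d / (d - 1) - β : ℝ) with hr
  have hr1 : 1 < r := Real.one_lt_rpow (by norm_num) (by linarith)
  have hr10 : 0 < r - 1 := by linarith
  refine ⟨C₁ * 2 ^ (β - 1) + C₂ * 2 ^ (2 * d / (d - 1) : ℝ) / (r - 1), by positivity, ?_⟩
  intro V S p hV h
  have hV0 : 0 < V := by linarith
  set L := Real.log V with hL
  have hL0 : 0 < L := Real.log_pos (by linarith)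
  -- This `τ` equates the two contributions `V τ^(β-1)` and `L^(d(d+1)/(d-1)) τ^(β-2d/(d-1))`, as
  -- `e1` and `e2` verify.
  set τ : ℝ := L ^ (d : ℝ) * V ^ (-((d - 1) / (d + 1)) : ℝ) with hτ
  have hτ0 : 0 < τ := by positivity
  have hτV : V ^ (-(d + 2 : ℝ)) ≤ τ := by
    have h1 : V ^ (-d : ℝ) ≤ L ^ (d : ℝ) := by
      rw [Real.rpow_neg hV0.le, ← Real.inv_rpow hV0.le]
      exact Real.rpow_le_rpow (by positivity) (inv_le_log hV) (by linarith)
    have h2 : V ^ (-2 : ℝ) ≤ V ^ (-((d - 1) / (d + 1)) : ℝ) := by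
      refine Real.rpow_le_rpow_of_exponent_le (by linarith) ?_
      have : ((d : ℝ) - 1) / (d + 1) ≤ 2 := by
        rw [div_le_iff₀ (by linarith)]; linarith
      linarith
    calc V ^ (-(d + 2 : ℝ)) = V ^ (-d : ℝ) * V ^ (-2 : ℝ) := by
          rw [← Real.rpow_add hV0]; congr 1; ring
      _ ≤ τ := mul_le_mul h1 h2 (by positivity) (by positivity)
  obtain ⟨m, hm, hsum⟩ := h.sum_rpow_le hβ hC₁ hV hτ0 hτV
  refine hsum.trans ?_
  rw [← hr]
  -- The ratio exceeds one, so the smallest influences above `τ` dominate.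
  have hgeom : ∑ j ∈ Finset.range m, r ^ j ≤ τ ^ (β - 2 * d / (d - 1) : ℝ) / (r - 1) := by
    rcases eq_or_ne m 0 with rfl | hm0
    · simp only [Finset.range_zero, Finset.sum_empty]; positivity
    · rw [geom_sum_eq hr1.ne']
      refine div_le_div_of_nonneg_right ?_ hr10.le
      have h1 : r ^ m = ((1 / 2 : ℝ) ^ m) ^ (β - 2 * d / (d - 1) : ℝ) := by
        rw [one_div, inv_pow, Real.inv_rpow (by positivity), ← Real.rpow_neg (by positivity),
          ← Real.rpow_natCast, ← Real.rpow_natCast, ← Real.rpow_mul (by norm_num),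
          ← Real.rpow_mul (by norm_num)]
        congr 1
        ring
      have h2 : ((1 / 2 : ℝ) ^ m) ^ (β - 2 * d / (d - 1) : ℝ) ≤ τ ^ (β - 2 * d / (d - 1) : ℝ) :=
        Real.rpow_le_rpow_of_nonpos hτ0 (hm hm0) (by linarith)
      linarith
  have e1 : V * τ ^ (β - 1) = V ^ (((d - 1) / (d + 1)) * (2 * d / (d - 1) - β) : ℝ) *
      L ^ ((β - 1) * d : ℝ) := by
    rw [hτ, Real.mul_rpow (by positivity) (by positivity), ← Real.rpow_mul hL0.le,
      ← Real.rpow_mul hV0.le]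
    have : (((d - 1) / (d + 1)) * (2 * d / (d - 1) - β) : ℝ) =
        1 + -((d - 1) / (d + 1)) * (β - 1) := by
      field_simp
      ring
    rw [this, Real.rpow_add hV0, Real.rpow_one, mul_comm (d : ℝ)]
    ring
  have e2 : L ^ (d * (d + 1) / (d - 1) : ℝ) * τ ^ (β - 2 * d / (d - 1) : ℝ) =
      V ^ (((d - 1) / (d + 1)) * (2 * d / (d - 1) - β) : ℝ) * L ^ ((β - 1) * d : ℝ) := by
    rw [hτ, Real.mul_rpow (by positivity) (by positivity), ← Real.rpow_mul hL0.le,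
      ← Real.rpow_mul hV0.le, ← mul_assoc, ← Real.rpow_add hL0, mul_comm]
    congr 2
    · ring
    · field_simp
      ring
  rw [Real.mul_rpow (by norm_num) hτ0.le, add_mul]
  refine add_le_add (le_of_eq ?_) ?_
  · rw [← e1]; ring
  · rw [← e2]
    calc _ ≤ C₂ * L ^ (d * (d + 1) / (d - 1) : ℝ) * 2 ^ (2 * d / (d - 1) : ℝ) *
          (τ ^ (β - 2 * d / (d - 1) : ℝ) / (r - 1)) := by gcongr
      _ = _ := by field_simp

/-- For supercritical or critical powers the small influences contribute a bounded amount. -/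
lemma mul_rpow_le_of_le (hd : 2 ≤ d) {β : ℝ} (hβ : 2 * d / (d - 1) ≤ β) {V : ℝ} (hV : 2 ≤ V) :
    V * (2 * V ^ (-(d + 2 : ℝ))) ^ (β - 1) ≤ 2 ^ (β - 1) := by
  have hd2 : (2 : ℝ) ≤ d := by exact_mod_cast hd
  have hd1 : (0 : ℝ) < d - 1 := by linarith
  have hV0 : 0 < V := by linarith
  have hγ : (2 : ℝ) ≤ 2 * d / (d - 1) := by rw [le_div_iff₀ hd1]; linarith
  rw [Real.mul_rpow (by norm_num) (by positivity), ← Real.rpow_mul hV0.le]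
  have h1 : V * V ^ (-(d + 2 : ℝ) * (β - 1)) ≤ 1 := by
    rw [← Real.rpow_one_add' hV0.le]
    · refine Real.rpow_le_one_of_one_le_of_nonpos (by linarith) ?_
      nlinarith
    · nlinarith
  calc _ = 2 ^ (β - 1) * (V * V ^ (-(d + 2 : ℝ) * (β - 1))) := by ring
    _ ≤ 2 ^ (β - 1) * 1 := by gcongr
    _ = _ := mul_one _

lemma le_mul_log_rpow {V κ : ℝ} (hV : 2 ≤ V) (hκ : 0 ≤ κ) :
    1 ≤ (Real.log 2)⁻¹ ^ κ * Real.log V ^ κ := by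
  have hl : 0 < Real.log 2 := Real.log_pos (by norm_num)
  have h1 : Real.log 2 ≤ Real.log V := Real.log_le_log (by norm_num) hV
  rw [← Real.mul_rpow (by positivity) (hl.le.trans h1)]
  refine Real.one_le_rpow ?_ hκ
  rw [← div_eq_inv_mul, one_le_div hl]
  exact h1

lemma exists_sum_rpow_le_of_eq (hd : 2 ≤ d) {C₁ C₂ : ℝ} (hC₁ : 0 < C₁) (hC₂ : 0 < C₂) {β : ℝ}
    (hβ : 1 ≤ β) (hβγ : β = 2 * d / (d - 1)) :
    ∃ C : ℝ, 0 < C ∧ ∀ (V : ℝ) (S : Finset ι) (p : ι → ℝ), 2 ≤ V → CountBound d C₁ C₂ V S p →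
      ∑ i ∈ S, p i ^ β ≤ C * Real.log V ^ (d * (d + 1) / (d - 1) + 1 : ℝ) := by
  have hd2 : (2 : ℝ) ≤ d := by exact_mod_cast hd
  have hd1 : (0 : ℝ) < d - 1 := by linarith
  have hl : 0 < Real.log 2 := Real.log_pos (by norm_num)
  refine ⟨C₁ * 2 ^ (β - 1) * (Real.log 2)⁻¹ ^ (d * (d + 1) / (d - 1) + 1 : ℝ) +
    C₂ * 2 ^ (2 * d / (d - 1) : ℝ) * ((d + 2) / Real.log 2), by positivity, ?_⟩
  intro V S p hV h
  have hV0 : 0 < V := by linarith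
  set L := Real.log V with hL
  have hL0 : 0 < L := Real.log_pos (by linarith)
  obtain ⟨m, hm, hsum⟩ := h.sum_rpow_le hβ hC₁ hV (Real.rpow_pos_of_pos hV0 _) le_rfl
  refine hsum.trans ?_
  -- At the critical exponent all layers contribute equally, and their number is `O(log V)`: this is
  -- the extra logarithm.
  have hmL : (m : ℝ) ≤ (d + 2) / Real.log 2 * L := by
    rcases eq_or_ne m 0 with rfl | hm0
    · simp only [Nat.cast_zero]; positivity
    · have h1 := Real.log_le_log (Real.rpow_pos_of_pos hV0 _) (hm hm0)
      rw [Real.log_rpow hV0, Real.log_pow, one_div, Real.log_inv, ← hL] at h1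
      rw [div_mul_eq_mul_div, le_div_iff₀ hl]
      linarith
  rw [add_mul]
  refine add_le_add ?_ ?_
  · calc C₁ * V * (2 * V ^ (-(d + 2 : ℝ))) ^ (β - 1)
        = C₁ * (V * (2 * V ^ (-(d + 2 : ℝ))) ^ (β - 1)) := by ring
      _ ≤ C₁ * 2 ^ (β - 1) := by gcongr; exact mul_rpow_le_of_le hd hβγ.ge hV
      _ ≤ C₁ * 2 ^ (β - 1) * ((Real.log 2)⁻¹ ^ (d * (d + 1) / (d - 1) + 1 : ℝ) *
          L ^ (d * (d + 1) / (d - 1) + 1 : ℝ)) :=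
          le_mul_of_one_le_right (by positivity) (le_mul_log_rpow hV (by positivity))
      _ = _ := by ring
  · rw [hβγ, sub_self, Real.rpow_zero]
    simp only [one_pow, Finset.sum_const, Finset.card_range, nsmul_eq_mul, mul_one]
    calc _ ≤ C₂ * L ^ (d * (d + 1) / (d - 1) : ℝ) * 2 ^ (2 * d / (d - 1) : ℝ) *
          ((d + 2) / Real.log 2 * L) := by gcongr
      _ = _ := by rw [Real.rpow_add hL0, Real.rpow_one]; ring

lemma exists_sum_rpow_le_of_gt (hd : 2 ≤ d) {C₁ C₂ : ℝ} (hC₁ : 0 < C₁) (hC₂ : 0 < C₂) {β : ℝ}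
    (hβ : 1 ≤ β) (hβγ : 2 * d / (d - 1) < β) :
    ∃ C : ℝ, 0 < C ∧ ∀ (V : ℝ) (S : Finset ι) (p : ι → ℝ), 2 ≤ V → CountBound d C₁ C₂ V S p →
      ∑ i ∈ S, p i ^ β ≤ C * Real.log V ^ (d * (d + 1) / (d - 1) : ℝ) := by
  have hd2 : (2 : ℝ) ≤ d := by exact_mod_cast hd
  have hd1 : (0 : ℝ) < d - 1 := by linarith
  have hl : 0 < Real.log 2 := Real.log_pos (by norm_num)
  set r : ℝ := 2 ^ (2 * d / (d - 1) - β : ℝ) with hr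
  have hr0 : 0 < r := by positivity
  have hr1 : r < 1 := Real.rpow_lt_one_of_one_lt_of_neg (by norm_num) (by linarith)
  have hr10 : 0 < 1 - r := by linarith
  refine ⟨C₁ * 2 ^ (β - 1) * (Real.log 2)⁻¹ ^ (d * (d + 1) / (d - 1) : ℝ) +
    C₂ * 2 ^ (2 * d / (d - 1) : ℝ) * (1 / (1 - r)), by positivity, ?_⟩
  intro V S p hV h
  have hV0 : 0 < V := by linarith
  set L := Real.log V with hL
  have hL0 : 0 < L := Real.log_pos (by linarith)
  obtain ⟨m, -, hsum⟩ := h.sum_rpow_le hβ hC₁ hV (Real.rpow_pos_of_pos hV0 _) le_rfl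
  refine hsum.trans ?_
  rw [← hr]
  have hgeom : ∑ j ∈ Finset.range m, r ^ j ≤ 1 / (1 - r) := by
    rw [one_div, ← tsum_geometric_of_lt_one hr0.le hr1]
    exact (summable_geometric_of_lt_one hr0.le hr1).sum_le_tsum _ fun j _ => by positivity
  rw [add_mul]
  refine add_le_add ?_ ?_
  · calc C₁ * V * (2 * V ^ (-(d + 2 : ℝ))) ^ (β - 1)
        = C₁ * (V * (2 * V ^ (-(d + 2 : ℝ))) ^ (β - 1)) := by ring
      _ ≤ C₁ * 2 ^ (β - 1) := by gcongr; exact mul_rpow_le_of_le hd hβγ.le hV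
      _ ≤ C₁ * 2 ^ (β - 1) * ((Real.log 2)⁻¹ ^ (d * (d + 1) / (d - 1) : ℝ) *
          L ^ (d * (d + 1) / (d - 1) : ℝ)) :=
          le_mul_of_one_le_right (by positivity) (le_mul_log_rpow hV (by positivity))
      _ = _ := by ring
  · calc _ ≤ C₂ * L ^ (d * (d + 1) / (d - 1) : ℝ) * 2 ^ (2 * d / (d - 1) : ℝ) *
          (1 / (1 - r)) := by gcongr
      _ = _ := by ring

end sums

/-! ### Conclusion for the influences. -/

section influence

variable {G : Measure ℝ} [IsProbabilityMeasure G]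

/-- The influences satisfy the counting bound, uniformly in the endpoint. -/
lemma exists_countBound (hd : 2 ≤ d) (hG : IsAdmissibleWeight G) :
    ∃ C₁ C₂ : ℝ, 0 < C₁ ∧ 0 < C₂ ∧ ∀ v : Fin d → ℤ, 2 ≤ norm2 v → ∀ S : Finset (Edge d),
      CountBound d C₁ C₂ (norm2 v) S
        fun e => (envMeasure d G).real {t | e ∈ geodesic t 0 v} := by
  obtain ⟨a, b, α, ha, hab, hα, hsupp, hac, hdens⟩ := hG.exists_lower_bound
  have hd2 : (2 : ℝ) ≤ d := by exact_mod_cast hd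
  have hd1 : (0 : ℝ) < d - 1 := by linarith
  have hb : 0 < b := ha.trans hab
  have hl : 0 < Real.log 2 := Real.log_pos (by norm_num)
  obtain ⟨C, V₀, hC, hfar⟩ := exists_count_bound_far hd ha hab hα hsupp hac hdens
  set κ : ℝ := d * (d + 1) / (d - 1) with hκ
  have hκ0 : 0 ≤ κ := by positivity
  set C₁ := b / a * d with hC₁
  have hC₁0 : 0 < C₁ := by positivity
  have hsum : ∀ (v : Fin d → ℤ) (S : Finset (Edge d)),
      ∑ e ∈ S, (envMeasure d G).real {t | e ∈ geodesic t 0 v} ≤ C₁ * norm2 v := by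
    intro v S
    refine (sum_measureReal_geodesic_le ha hsupp hac v S).trans ?_
    rw [hC₁, mul_assoc]
    exact mul_le_mul_of_nonneg_left (l1_le_mul_norm2 v) (by positivity)
  refine ⟨C₁, C + C₁ * |V₀| * (Real.log 2)⁻¹ ^ κ, hC₁0, by positivity, fun v hv S =>
    ⟨fun e => measureReal_nonneg, fun e => measureReal_le_one, hsum v S, ?_⟩⟩
  intro ε hε hε1 E _ hE
  have hV0 : 0 < norm2 v := by linarith
  have hε0 : 0 < ε := lt_of_lt_of_le (Real.rpow_pos_of_pos hV0 _) hε
  have hL0 : 0 < Real.log (norm2 v) := Real.log_pos (by linarith)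
  rcases le_total V₀ (norm2 v) with h | h
  · refine (hfar v hv h ε hε hε1 E hE).trans ?_
    gcongr
    have : 0 ≤ C₁ * |V₀| * (Real.log 2)⁻¹ ^ κ := by positivity
    linarith
  -- For bounded `‖v‖` the first moment suffices: `ε |E|` is at most the sum of the influences, and
  -- the powers of `ε` and of the logarithm only cost constants.
  · have h1 := (Finset.card_nsmul_le_sum E _ ε hE).trans (hsum v E)
    rw [nsmul_eq_mul] at h1
    have h2 : (E.card : ℝ) ≤ C₁ * |V₀| * ε⁻¹ := by
      rw [← div_eq_mul_inv, le_div_iff₀ hε0]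
      refine h1.trans ?_
      gcongr
      exact h.trans (le_abs_self _)
    have h3 : ε⁻¹ ≤ ε ^ (-(2 * d / (d - 1)) : ℝ) := by
      rw [← Real.rpow_neg_one]
      refine Real.rpow_le_rpow_of_exponent_ge hε0 hε1 ?_
      have : (1 : ℝ) ≤ 2 * d / (d - 1) := by rw [le_div_iff₀ hd1]; linarith
      linarith
    calc (E.card : ℝ) ≤ C₁ * |V₀| * ε ^ (-(2 * d / (d - 1)) : ℝ) :=
          h2.trans (by gcongr)
      _ ≤ C₁ * |V₀| * ε ^ (-(2 * d / (d - 1)) : ℝ) *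
          ((Real.log 2)⁻¹ ^ κ * Real.log (norm2 v) ^ κ) :=
          le_mul_of_one_le_right (by positivity) (le_mul_log_rpow hv hκ0)
      _ = C₁ * |V₀| * (Real.log 2)⁻¹ ^ κ * ε ^ (-(2 * d / (d - 1)) : ℝ) *
          Real.log (norm2 v) ^ κ := by ring
      _ ≤ _ := by
          gcongr
          linarith

/-- Bounds on finite sums of powers of the influences pass to the whole edge set. -/
lemma tsum_influence_rpow_le {v : Fin d → ℤ} {β X : ℝ} (hβ : 0 ≤ β)
    (h : ∀ S : Finset (Edge d),
      ∑ e ∈ S, (envMeasure d G).real {t | e ∈ geodesic t 0 v} ^ β ≤ X) :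
    ∑' e : Edge d, influence G v e ^ β ≤ ENNReal.ofReal X := by
  rw [ENNReal.tsum_eq_iSup_sum]
  refine iSup_le fun S => ?_
  have : ∀ e : Edge d, influence G v e ^ β =
      ENNReal.ofReal ((envMeasure d G).real {t | e ∈ geodesic t 0 v} ^ β) := by
    intro e
    rw [← ENNReal.ofReal_rpow_of_nonneg measureReal_nonneg hβ, ofReal_measureReal]
    rfl
  simp only [this]
  rw [← ENNReal.ofReal_sum_of_nonneg fun e _ => Real.rpow_nonneg measureReal_nonneg _]
  exact ENNReal.ofReal_le_ofReal (h S)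

end influence

end FPP

theorem corollary1p3 (d : ℕ) (hd : 2 ≤ d) (G : Measure ℝ) [IsProbabilityMeasure G]
    (hG : FPP.IsAdmissibleWeight G) :
    (∀ β : ℝ, 1 ≤ β → ∃ C : ℝ, 0 < C ∧ ∀ v : Fin d → ℤ, 2 ≤ FPP.norm2 v →
      (β < 2 * d / (d - 1) →
        ∑' e : FPP.Edge d, FPP.influence G v e ^ β ≤
          ENNReal.ofReal (C *
            (FPP.norm2 v ^ (((d - 1) / (d + 1)) * (2 * d / (d - 1) - β) : ℝ) *
              Real.log (FPP.norm2 v) ^ ((β - 1) * d : ℝ)))) ∧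
      (β = 2 * d / (d - 1) →
        ∑' e : FPP.Edge d, FPP.influence G v e ^ β ≤
          ENNReal.ofReal (C * Real.log (FPP.norm2 v) ^ (d * (d + 1) / (d - 1) + 1 : ℝ))) ∧
      (2 * d / (d - 1) < β →
        ∑' e : FPP.Edge d, FPP.influence G v e ^ β ≤
          ENNReal.ofReal (C * Real.log (FPP.norm2 v) ^ (d * (d + 1) / (d - 1) : ℝ)))) ∧
    (∃ C : ℝ, 0 < C ∧ ∀ v : Fin d → ℤ, 2 ≤ FPP.norm2 v →
      ∑' e : FPP.Edge d, FPP.influence G v e ^ (2 : ℝ) ≤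
        ENNReal.ofReal (C * (FPP.norm2 v ^ (2 / (d + 1) : ℝ) * Real.log (FPP.norm2 v) ^ (d : ℝ)))) := by
  have hd2 : (2 : ℝ) ≤ d := by exact_mod_cast hd
  have hd1 : (0 : ℝ) < d - 1 := by linarith
  obtain ⟨C₁, C₂, hC₁, hC₂, hcount⟩ := FPP.exists_countBound hd hG
  refine ⟨fun β hβ => ?_, ?_⟩
  · have hβ0 : 0 ≤ β := by linarith
    rcases lt_trichotomy β (2 * d / (d - 1)) with h | h | h
    · obtain ⟨C, hC, hCall⟩ := FPP.exists_sum_rpow_le_of_lt (ι := FPP.Edge d) hd hC₁ hC₂ hβ h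
      refine ⟨C, hC, fun v hv => ⟨fun _ => ?_, fun h' => absurd h' h.ne, fun h' => absurd h' h.not_gt⟩⟩
      exact FPP.tsum_influence_rpow_le hβ0 fun S => hCall _ S _ hv (hcount v hv S)
    · obtain ⟨C, hC, hCall⟩ := FPP.exists_sum_rpow_le_of_eq (ι := FPP.Edge d) hd hC₁ hC₂ hβ h
      refine ⟨C, hC, fun v hv => ⟨fun h' => absurd h h'.ne, fun _ => ?_, fun h' => absurd h h'.ne'⟩⟩
      exact FPP.tsum_influence_rpow_le hβ0 fun S => hCall _ S _ hv (hcount v hv S)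
    · obtain ⟨C, hC, hCall⟩ := FPP.exists_sum_rpow_le_of_gt (ι := FPP.Edge d) hd hC₁ hC₂ hβ h
      refine ⟨C, hC, fun v hv => ⟨fun h' => absurd h' h.not_gt, fun h' => absurd h' h.ne', fun _ => ?_⟩⟩
      exact FPP.tsum_influence_rpow_le hβ0 fun S => hCall _ S _ hv (hcount v hv S)
  -- The exponent `2` is subcritical in every dimension.
  · have h2 : (2 : ℝ) < 2 * d / (d - 1) := by rw [lt_div_iff₀ hd1]; linarith
    obtain ⟨C, hC, hCall⟩ := FPP.exists_sum_rpow_le_of_lt (ι := FPP.Edge d) hd hC₁ hC₂ one_le_two h2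
    refine ⟨C, hC, fun v hv => FPP.tsum_influence_rpow_le zero_le_two fun S => ?_⟩
    have h3 := hCall _ S _ hv (hcount v hv S)
    have e1 : (((d - 1) / (d + 1)) * (2 * d / (d - 1) - 2) : ℝ) = 2 / (d + 1) := by
      field_simp
      ring
    have e2 : ((2 - 1) * d : ℝ) = d := by ring
    rwa [e1, e2] at h3
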